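/- Let $m,c\ge 0$ and $k_1,\dots,k_m$ be natural numbers, and let $t^0<t^f$. Consider the optimal control problem in flat coordinates with state $s=(y_i^{(j)})_{1\le i\le m,\,0\le j\le k_i-1}$ and control $a=(y_i^{(k_i)})_{1\le i\le m}$: minimize $$\Phi(s(t^f),a(t^f))+\int_{t^0}^{t^f}\Psi(s(t),a(t))\,dt$$ subject to the integrator dynamics $\dot s=I(s,a)$ (i.e. $\frac{d}{dt}y_i^{(j)}=y_i^{(j+1)}$), to $g(s(t),a(t),t)\le 0$ ($c$ components), and to boundary conditions $(s(t^0),s(t^f))\in B$. Here $\Phi,\Psi,g$ are $C^1$ on an open set $Y$ of pairs $(s,a)$ (respectively on $Y\times\mathbb R$). Along a trajectory, $s$ is continuous, $a$ is bounded and continuous except at finitely many interior junctions, off which the dynamics hold, and $(s,a)$ stays in a compact subset of $Y$. Let $(s,a)$ be a trajectory satisfying the boundary conditions, and let $\mu:[t^0,t^f]\to\mathbb R^c$ be bounded and continuous except at finitely many interior points. Put $P_{i,n}=\Psi_{y_i^{(n)}}+\mu^T g_{y_i^{(n)}}$ along $(s,a)$. Suppose that, for some $i$ and some $0\le j\le k_i-1$,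 the state $y_i^{(j)}$ is left free at a boundary $t^b\in\{t^0,t^f\}$, i.e. $B$ does not restrict its value there, and, if $t^b=t^f$, that $\partial\Phi/\partial y_i^{(j)}=0$ at the final point of the trajectory. Suppose also that $(s,a)$ and $\mu$ are continuous, and every $P_{l,n}$ ($1\le l\le m$, $0\le n\le k_l$) is $n$ times continuously differentiable, on a nondegenerate closed interval $A\subset[t^0,t^f]$ that has $t^b$ as an endpoint and does not contain the other boundary. Consider the costate-free boundary condition $$\sum_{n=1}^{k_i-j}(-1)^n\frac{d^{n-1}}{dt^{n-1}}\Big(\Psi_{y_i^{(j+n)}}+\mu^Tg_{y_i^{(j+n)}}\Big)\Big|_{t^b}=0 \qquad(\ast)$$ (one-sided derivatives). Call a trajectory stationary (with multipliers $\mu$) for a problem if the first variation of $\Phi+\int(\Psi+\mu^Tg)\,dt$ vanishes for all variations obeying the integrator dynamics whose boundary values are tangent to the boundary conditions of that problem. The fixed problem is the problem in which, in addition, $y_i^{(j)}(t^b)$ is prescribed to be its value on the given trajectory. Then: 1. For every costate $\lambda$ on $A$, i.e. every solution of $-\dot\lambda^T=H_s$, $0=H_a$ with $H=\Psi+\lambda^TI+\mu^Tg$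 along the trajectory, $\lambda^{y_i^{(j)}}(t^b)=0$ if and only if $(\ast)$ holds. If the trajectory is stationary for the fixed problem, then such a costate exists. 2. The trajectory is stationary for the problem with $y_i^{(j)}(t^b)$ free if and only if it is stationary for the fixed problem and $(\ast)$ holds. 3. Suppose that $Y$ and $B$ are convex, that $\Phi$, $\Psi$ and all $g_l(\cdot,t)$ are convex on $Y$, that the trajectory satisfies $g\le 0$, and that $\mu\ge 0$ and $\mu_l g_l=0$ along it. If it is stationary for the fixed problem and $(\ast)$ holds, then it is a global minimizer of the problem with $y_i^{(j)}(t^b)$ free. 4. If the trajectory is a local minimizer (in the uniform distance of $(s,a)$) of the problem with $y_i^{(j)}(t^b)$ free, $\mu\ge 0$ and $\mu_lg_l=0$ along it, and $g<0$ along it on $A$, then $(\ast)$ holds. -/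

import Mathlib

noncomputable section

namespace FlatControl

/-- The two ends of the time horizon. -/
inductive Endpoint
  | initial
  | final
  deriving DecidableEq

/-- Coordinates `y_i^{(n)}`, `0 ≤ n ≤ k i`, of the flat space. -/
abbrev JetIdx {m : ℕ} (k : Fin m → ℕ) : Type := (i : Fin m) × Fin (k i + 1)

/-- Coordinates `y_i^{(j)}`, `0 ≤ j ≤ k i - 1`, of the flat state `s`. -/
abbrev StateIdx {m : ℕ} (k : Fin m → ℕ) : Type := (i : Fin m) × Fin (k i)

/-- A point `(s, a)` of the flat space: the coordinates `y_i^{(j)}` with `j < k i` form the state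
`s`, the coordinates `y_i^{(k i)}` form the control `a`. -/
abbrev Jet {m : ℕ} (k : Fin m → ℕ) : Type := JetIdx k → ℝ

/-- The coordinate `y_i^{(j)}` of a state index, as a coordinate of the flat space. -/
def here {m : ℕ} {k : Fin m → ℕ} (p : StateIdx k) : JetIdx k := ⟨p.1, p.2.castSucc⟩

/-- The coordinate `y_i^{(j+1)}` that follows the state `y_i^{(j)}` in its integrator chain. -/
def next {m : ℕ} {k : Fin m → ℕ} (p : StateIdx k) : JetIdx k := ⟨p.1, p.2.succ⟩

/-- The control coordinate `y_i^{(k i)}`. -/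
def top {m : ℕ} (k : Fin m → ℕ) (i : Fin m) : JetIdx k := ⟨i, Fin.last (k i)⟩

/-- The partial derivative of `F` with respect to the coordinate `q`. -/
def pderiv {m : ℕ} {k : Fin m → ℕ} (F : Jet k → ℝ) (q : JetIdx k) (w : Jet k) : ℝ :=
  fderiv ℝ F w (Pi.single q 1)

/-- The data of an optimal control problem in the flat space: horizon `[t0, tf]`, the set `Y` on
which the data live, final cost `Phi`, running cost `Psi`, trajectory constraints
`g l (s, a) t ≤ 0`, and the set `B` of the permitted pairs (initial state, final state). -/
structure Problem {m : ℕ} (k : Fin m → ℕ) (c : ℕ) where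
  t0 : ℝ
  tf : ℝ
  Y : Set (Jet k)
  Phi : Jet k → ℝ
  Psi : Jet k → ℝ
  g : Fin c → Jet k → ℝ → ℝ
  B : Set (Endpoint → StateIdx k → ℝ)

/-- `z = (s, a)` obeys the integrator dynamics `ds/dt = I(s, a)` on `[t0, tf]`: the state is
continuous, the control is bounded and continuous except at finitely many interior junctions, and
the dynamics hold except at these junctions. -/
def IsIntegratorPath {m : ℕ} {k : Fin m → ℕ} (t0 tf : ℝ) (z : ℝ → Jet k) : Prop :=
  ∃ J : Set ℝ, J.Finite ∧ J ⊆ Set.Ioo t0 tf ∧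
    (∀ p : StateIdx k, ContinuousOn (fun t => z t (here p)) (Set.Icc t0 tf)) ∧
    ContinuousOn z (Set.Icc t0 tf \ J) ∧
    (∃ C : ℝ, ∀ t ∈ Set.Icc t0 tf, ‖z t‖ ≤ C) ∧
    ∀ p : StateIdx k, ∀ t ∈ Set.Icc t0 tf \ J,
      HasDerivWithinAt (fun τ => z τ (here p)) (z t (next p)) (Set.Icc t0 tf) t

/-- A vector of multiplier functions, bounded and continuous except at finitely many interior
junctions. -/
def IsPiecewise {c : ℕ} (t0 tf : ℝ) (μ : ℝ → Fin c → ℝ) : Prop :=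
  ∃ J : Set ℝ, J.Finite ∧ J ⊆ Set.Ioo t0 tf ∧
    ContinuousOn μ (Set.Icc t0 tf \ J) ∧ ∃ C : ℝ, ∀ t ∈ Set.Icc t0 tf, ‖μ t‖ ≤ C

namespace Problem

variable {m : ℕ} {k : Fin m → ℕ} {c : ℕ}

/-- The horizon is nondegenerate, and the data are continuously differentiable on the open set
`Y`. -/
structure Regular (Q : Problem k c) : Prop where
  lt : Q.t0 < Q.tf
  isOpen : IsOpen Q.Y
  phi : ContDiffOn ℝ 1 Q.Phi Q.Y
  psi : ContDiffOn ℝ 1 Q.Psi Q.Y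
  g : ∀ l, ContDiffOn ℝ 1 (fun x : Jet k × ℝ => Q.g l x.1 x.2) (Q.Y ×ˢ Set.univ)

/-- The time of an endpoint. -/
def time (Q : Problem k c) : Endpoint → ℝ
  | .initial => Q.t0
  | .final => Q.tf

/-- The part of the horizon between the endpoint `b` and the time `t1`. -/
def arc (Q : Problem k c) (b : Endpoint) (t1 : ℝ) : Set ℝ :=
  match b with
  | .initial => Set.Icc Q.t0 t1
  | .final => Set.Icc t1 Q.tf

/-- The initial and the final state of `z`. -/
def bd (Q : Problem k c) (z : ℝ → Jet k) : Endpoint → StateIdx k → ℝ :=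
  fun b p => z (Q.time b) (here p)

/-- A trajectory of the problem, disregarding the trajectory constraints: it obeys the integrator
dynamics, stays in a compact part of `Y`, and satisfies the boundary conditions. -/
def IsTrajectory (Q : Problem k c) (z : ℝ → Jet k) : Prop :=
  IsIntegratorPath Q.t0 Q.tf z ∧
    (∃ K : Set (Jet k), IsCompact K ∧ K ⊆ Q.Y ∧ ∀ t ∈ Set.Icc Q.t0 Q.tf, z t ∈ K) ∧
    Q.bd z ∈ Q.B

/-- A trajectory that satisfies the trajectory constraints. -/
def IsFeasible (Q : Problem k c) (z : ℝ → Jet k) : Prop :=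
  Q.IsTrajectory z ∧ ∀ t ∈ Set.Icc Q.t0 Q.tf, ∀ l, Q.g l (z t) t ≤ 0

/-- The cost. -/
def cost (Q : Problem k c) (z : ℝ → Jet k) : ℝ :=
  Q.Phi (z Q.tf) + ∫ t in Q.t0..Q.tf, Q.Psi (z t)

/-- A global minimizer. -/
def IsMinimizer (Q : Problem k c) (z : ℝ → Jet k) : Prop :=
  Q.IsFeasible z ∧ ∀ z', Q.IsFeasible z' → Q.cost z ≤ Q.cost z'

/-- A local minimizer, with respect to the uniform distance of state and control. -/
def IsLocalMinimizer (Q : Problem k c) (z : ℝ → Jet k) : Prop :=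
  Q.IsFeasible z ∧ ∃ δ > 0, ∀ z', Q.IsFeasible z' →
    (∀ t ∈ Set.Icc Q.t0 Q.tf, ‖z' t - z t‖ ≤ δ) → Q.cost z ≤ Q.cost z'

/-- The cost augmented by the trajectory constraints with multipliers `μ`. -/
def augCost (Q : Problem k c) (μ : ℝ → Fin c → ℝ) (z : ℝ → Jet k) : ℝ :=
  Q.Phi (z Q.tf) + ∫ t in Q.t0..Q.tf, (Q.Psi (z t) + ∑ l, μ t l * Q.g l (z t) t)

/-- First-order optimality of `z` with multipliers `μ`: the first variation of the augmented cost
vanishes for every variation that obeys the integrator dynamics and whose boundary values are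
tangent to the boundary conditions. -/
def IsStationary (Q : Problem k c) (μ : ℝ → Fin c → ℝ) (z : ℝ → Jet k) : Prop :=
  ∀ ζ : ℝ → Jet k, IsIntegratorPath Q.t0 Q.tf ζ → Q.bd ζ ∈ tangentConeAt ℝ Q.B (Q.bd z) →
    HasDerivAt (fun ε : ℝ => Q.augCost μ (fun t => z t + ε • ζ t)) 0 0

/-- Nonnegative multipliers with `μ_l g_l = 0` along the trajectory. -/
def IsComplementary (Q : Problem k c) (μ : ℝ → Fin c → ℝ) (z : ℝ → Jet k) : Prop :=
  ∀ t ∈ Set.Icc Q.t0 Q.tf, ∀ l, 0 ≤ μ t l ∧ μ t l * Q.g l (z t) t = 0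

/-- The state `p` is left free at the endpoint `b`: it can be selected arbitrarily. -/
def IsFree (Q : Problem k c) (b : Endpoint) (p : StateIdx k) : Prop :=
  ∀ β ∈ Q.B, ∀ r : ℝ, Function.update β b (Function.update (β b) p r) ∈ Q.B

/-- The same problem with the value `r` prescribed for the state `p` at the endpoint `b`. -/
def fixAt (Q : Problem k c) (b : Endpoint) (p : StateIdx k) (r : ℝ) : Problem k c :=
  { Q with B := Q.B ∩ {β | β b p = r} }

/-- The Hamiltonian `Ψ + λᵀ I + μᵀ g`, with `I` the integrator dynamics. -/
def hamiltonian (Q : Problem k c) (lam : StateIdx k → ℝ) (μ : Fin c → ℝ) (w : Jet k) (t : ℝ) : ℝ :=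
  Q.Psi w + ∑ p, lam p * w (next p) + ∑ l, μ l * Q.g l w t

/-- `lam` is a costate of `z` and `μ` on `S`: the equations `-dλ/dt = H_s` and `0 = H_a` hold. -/
def IsCostateOn (Q : Problem k c) (S : Set ℝ) (μ : ℝ → Fin c → ℝ) (z : ℝ → Jet k)
    (lam : ℝ → StateIdx k → ℝ) : Prop :=
  ∀ t ∈ S,
    (∀ p : StateIdx k, HasDerivWithinAt (fun τ => lam τ p)
      (-pderiv (fun w => Q.hamiltonian (lam t) (μ t) w t) (here p) (z t)) S t) ∧
    ∀ i : Fin m, pderiv (fun w => Q.hamiltonian (lam t) (μ t) w t) (top k i) (z t) = 0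

/-- `Ψ_q + μᵀ g_q` along `z`, for the coordinate `q`. -/
def gradAlong (Q : Problem k c) (μ : ℝ → Fin c → ℝ) (z : ℝ → Jet k) (q : JetIdx k) (t : ℝ) : ℝ :=
  pderiv Q.Psi q (z t) + ∑ l, μ t l * pderiv (fun w => Q.g l w t) q (z t)

/-- For `p = (i, j)`, the costate-free expression
`∑_{n=1}^{k_i-j} (-1)^n (d/dt)^{n-1} (Ψ_{y_i^{(j+n)}} + μᵀ g_{y_i^{(j+n)}})` on the arc `S`;
the summation index below is `n - 1`. -/
def costateFree (Q : Problem k c) (S : Set ℝ) (μ : ℝ → Fin c → ℝ) (z : ℝ → Jet k)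
    (p : StateIdx k) (t : ℝ) : ℝ :=
  ∑ n : Fin (k p.1 - p.2), (-1 : ℝ) ^ ((n : ℕ) + 1) *
    iteratedDerivWithin (n : ℕ)
      (Q.gradAlong μ z ⟨p.1, ⟨(p.2 : ℕ) + ((n : ℕ) + 1), by have := n.2; omega⟩⟩) S t

end Problem

end FlatControl

end

/-! Fix a chain `i` and write `P_n` for its gradients along the trajectory and `A_j = ∑ (-1)^n
(d/dt)^n P_{j+n}` for the Euler sums (`altSum`). They satisfy `A_{j+1}' = P_j - A_j` and `A_{k+1} =
0`, where `k` is the length of the chain, and the left side of (∗) is `-A_{j+1}(t^b)`.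

The costate equations are the same recursion: read from the control downwards, they force `λ_j =
-A_{j+1}` (`costate_eq_costateFree`). Conversely these functions form a costate as soon as `A_0 =
0`, which is the Euler-Lagrange equation.

Repeated integration by parts (`integral_sum_mul_iteratedDeriv`) turns the first variation along a
chain generated by `φ` into `∫ A_0 φ`, the boundary terms `A_{n+1} φ^{(n)}` and the variation of
`Φ`. Test functions with compact support inside the arc give `A_0 = 0`. A test function whose only
nonzero derivative at `t^b` is the `j`-th then leaves exactly `±A_{j+1}(t^b)` (`exists_variation`),
so (∗) says that the first variation vanishes in one direction `η`.

A variation tangent to the free problem becomes tangent to the fixed one after subtracting a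
multiple of `η` (`IsFree.sub_smul_mem_tangentConeAt`); linearity of the first variation gives the
equivalence of stationarity. Global optimality is then Lagrangian sufficiency for convex data. At a
local minimizer with inactive constraints on the arc, `μ` vanishes there and small multiples of
either sign of these test variations are feasible, so the first variation vanishes along them. -/

open Set MeasureTheory Filter Topology
open scoped ContDiff Interval

noncomputable section

namespace FlatControl

/-! ### Euler sums and repeated integration by parts. -/

section AltSum

/-- The alternating sum `∑ (-1)^n (d/dt)^n P_{j+n}`, over the indices `j ≤ j + n ≤ k`. -/
def altSum (S : Set ℝ) (P : ℕ → ℝ → ℝ) (k j : ℕ) (t : ℝ) : ℝ :=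
  ∑ n ∈ Finset.range (k + 1 - j), (-1 : ℝ) ^ n * iteratedDerivWithin n (P (j + n)) S t

variable {S : Set ℝ} {P : ℕ → ℝ → ℝ} {k : ℕ}

theorem altSum_of_lt {j : ℕ} (hj : k < j) (t : ℝ) : altSum S P k j t = 0 := by
  have : k + 1 - j = 0 := by omega
  simp [altSum, this]

theorem hasDerivWithinAt_altSum (hS : UniqueDiffOn ℝ S)
    (hP : ∀ n ≤ k, ContDiffOn ℝ n (P n) S) {j : ℕ} (hj : j ≤ k) {t : ℝ} (ht : t ∈ S) :
    HasDerivWithinAt (altSum S P k (j + 1)) (P j t - altSum S P k j t) S t := by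
  -- The term `n = 0` of `altSum` at `j` is `P j`; the remaining terms are, up to sign, the
  -- derivatives of the terms at `j + 1`.
  have h1 : P j t - altSum S P k j t = ∑ n ∈ Finset.range (k + 1 - (j + 1)),
      (-1 : ℝ) ^ n * iteratedDerivWithin (n + 1) (P (j + 1 + n)) S t := by
    have e : k + 1 - j = (k + 1 - (j + 1)) + 1 := by omega
    rw [altSum, e, Finset.sum_range_succ']
    simp only [pow_zero, one_mul, add_zero, iteratedDerivWithin_zero, pow_succ]
    rw [sub_add_cancel_right, ← Finset.sum_neg_distrib]
    refine Finset.sum_congr rfl fun n _ => ?_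
    rw [(by omega : j + (n + 1) = j + 1 + n)]
    ring
  rw [h1]
  unfold altSum
  refine HasDerivWithinAt.fun_sum fun n hn => HasDerivWithinAt.const_mul _ ?_
  rw [Finset.mem_range] at hn
  rw [iteratedDerivWithin_succ]
  refine DifferentiableWithinAt.hasDerivWithinAt ?_
  refine (hP (j + 1 + n) (by omega)).differentiableOn_iteratedDerivWithin ?_ hS t ht
  exact_mod_cast (by omega : n < j + 1 + n)

theorem continuousOn_altSum (hS : UniqueDiffOn ℝ S)
    (hP : ∀ n ≤ k, ContDiffOn ℝ n (P n) S) (j : ℕ) : ContinuousOn (altSum S P k j) S := by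
  unfold altSum
  refine continuousOn_finsetSum _ fun n hn => continuousOn_const.mul ?_
  rw [Finset.mem_range] at hn
  refine (hP (j + n) (by omega)).continuousOn_iteratedDerivWithin ?_ hS
  exact_mod_cast (by omega : n ≤ j + n)

/-- Repeated integration by parts. -/
theorem integral_sum_mul_iteratedDeriv {α β : ℝ} (hαβ : α < β)
    (hP : ∀ n ≤ k, ContDiffOn ℝ n (P n) (Icc α β)) {φ : ℝ → ℝ} (hφ : ContDiff ℝ ∞ φ) :
    ∫ t in α..β, ∑ n ∈ Finset.range (k + 1), P n t * iteratedDeriv n φ t =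
      (∫ t in α..β, altSum (Icc α β) P k 0 t * φ t) +
        ((∑ n ∈ Finset.range (k + 1), altSum (Icc α β) P k (n + 1) β * iteratedDeriv n φ β) -
          ∑ n ∈ Finset.range (k + 1), altSum (Icc α β) P k (n + 1) α * iteratedDeriv n φ α) := by
  have hS := uniqueDiffOn_Icc hαβ
  have hcφ : ∀ n, Continuous (iteratedDeriv n φ) := fun n =>
    hφ.continuous_iteratedDeriv n (by exact_mod_cast le_top)
  have hdφ : ∀ n t, HasDerivAt (iteratedDeriv n φ) (iteratedDeriv (n + 1) φ t) t := fun n t => by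
    rw [iteratedDeriv_succ]
    exact (hφ.differentiable_iteratedDeriv n (by exact_mod_cast ENat.natCast_lt_top n) t).hasDerivAt
  have hcA := continuousOn_altSum hS hP
  have hd : ∀ t ∈ Icc α β, HasDerivWithinAt
      (fun t => ∑ n ∈ Finset.range (k + 1), altSum (Icc α β) P k (n + 1) t * iteratedDeriv n φ t)
      ((∑ n ∈ Finset.range (k + 1), P n t * iteratedDeriv n φ t) -
        altSum (Icc α β) P k 0 t * φ t) (Icc α β) t := by
    intro t ht
    have h := HasDerivWithinAt.fun_sum (u := Finset.range (k + 1)) (x := t) (s := Icc α β)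
      (A := fun n t => altSum (Icc α β) P k (n + 1) t * iteratedDeriv n φ t)
      (A' := fun n => (P n t - altSum (Icc α β) P k n t) * iteratedDeriv n φ t +
        altSum (Icc α β) P k (n + 1) t * iteratedDeriv (n + 1) φ t) (fun n hn =>
        (hasDerivWithinAt_altSum hS hP (Nat.lt_succ_iff.1 (Finset.mem_range.1 hn)) ht).mul
          (hdφ n t).hasDerivWithinAt)
    refine h.congr_deriv ?_
    -- The sum telescopes in `n`: the upper end vanishes because the Euler sum at `k + 1` is empty,
    -- and the lower end leaves `-A_0 φ`.
    have h2 := Finset.sum_range_sub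
      (fun n => altSum (Icc α β) P k n t * iteratedDeriv n φ t) (k + 1)
    simp only [altSum_of_lt (Nat.lt_succ_self k), zero_mul, zero_sub, iteratedDeriv_zero] at h2
    symm
    rw [sub_eq_add_neg, ← h2, ← Finset.sum_add_distrib]
    exact Finset.sum_congr rfl fun n _ => by ring
  have hc1 : ContinuousOn (fun t => ∑ n ∈ Finset.range (k + 1), P n t * iteratedDeriv n φ t)
      (Icc α β) := continuousOn_finsetSum _ fun n hn =>
    (hP n (Nat.lt_succ_iff.1 (Finset.mem_range.1 hn))).continuousOn.mul (hcφ n).continuousOn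
  have hc2 : ContinuousOn (fun t => altSum (Icc α β) P k 0 t * φ t) (Icc α β) :=
    (hcA 0).mul hφ.continuous.continuousOn
  have hi1 := hc1.intervalIntegrable_of_Icc (μ := volume) hαβ.le
  have hi2 := hc2.intervalIntegrable_of_Icc (μ := volume) hαβ.le
  have hftc := intervalIntegral.integral_eq_sub_of_hasDerivAt_of_le hαβ.le
    (fun t ht => (hd t ht).continuousWithinAt)
    (fun t ht => (hd t (Ioo_subset_Icc_self ht)).hasDerivAt (Icc_mem_nhds ht.1 ht.2))
    (hi1.sub hi2)
  rw [intervalIntegral.integral_sub hi1 hi2] at hftc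
  linarith

end AltSum

/-! ### Test functions and the fundamental lemma. -/

/-- A smooth function with a prescribed jet of monomial type at `a`, supported close to `a`. -/
theorem exists_contDiff_iteratedDeriv_eq (a : ℝ) {δ : ℝ} (hδ : 0 < δ) (j : ℕ) :
    ∃ φ : ℝ → ℝ, ContDiff ℝ ∞ φ ∧ (∀ n t, δ ≤ |t - a| → iteratedDeriv n φ t = 0) ∧
      ∀ n, iteratedDeriv n φ a = if n = j then 1 else 0 := by
  -- The outer radius is strictly below `δ`, so that `φ` vanishes on a neighbourhood of every point
  -- at distance at least `δ`, and all its derivatives vanish there.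
  let χ : ContDiffBump a := ⟨δ / 4, δ / 2, by positivity, by linarith⟩
  let φ : ℝ → ℝ := fun t => χ t * ((j.factorial : ℝ)⁻¹ * (t - a) ^ j)
  refine ⟨φ, χ.contDiff.mul (by fun_prop), fun n t ht => ?_, fun n => ?_⟩
  · have h0 : φ =ᶠ[𝓝 t] fun _ => 0 := by
      have : {x : ℝ | δ / 2 < |x - a|} ∈ 𝓝 t :=
        (isOpen_lt continuous_const (by fun_prop)).mem_nhds (by
          simp only [mem_ofPred_eq]; linarith)
      filter_upwards [this] with x hx
      simp [φ, χ.zero_of_le_dist (x := x) (by rw [Real.dist_eq]; exact le_of_lt hx)]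
    rw [h0.iteratedDeriv_eq, iteratedDeriv_const]
    simp
  · have h1 : φ =ᶠ[𝓝 a] fun t => (j.factorial : ℝ)⁻¹ * (t - a) ^ j := by
      filter_upwards [χ.eventuallyEq_one] with x hx
      simp [φ, hx]
    rw [h1.iteratedDeriv_eq]
    rw [iteratedDeriv_const_mul_field, iteratedDeriv_comp_sub_const n (fun t : ℝ => t ^ j) a]
    simp only [iteratedDeriv_pow, sub_self]
    split_ifs with h
    · subst h
      simp [Nat.descFactorial_self, Nat.factorial_ne_zero]
    · rcases lt_or_gt_of_ne h with h | h
      · rw [zero_pow (by omega : j - n ≠ 0)]; simp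
      · simp [Nat.descFactorial_of_lt h]

/-- The fundamental lemma of the calculus of variations. -/
theorem eqOn_zero_of_integral_mul_eq_zero {α β : ℝ} (hαβ : α < β) {f : ℝ → ℝ}
    (hf : ContinuousOn f (Icc α β))
    (h : ∀ φ : ℝ → ℝ, ContDiff ℝ ∞ φ → tsupport φ ⊆ Ioo α β → ∫ t in α..β, f t * φ t = 0) :
    ∀ t ∈ Icc α β, f t = 0 := by
  -- Vanishing almost everywhere is upgraded by continuity, first to the open interval and then to
  -- its closure.
  have h1 : ∀ᵐ t, t ∈ Ioo α β → f t = 0 := by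
    refine isOpen_Ioo.ae_eq_zero_of_integral_contDiff_smul_eq_zero
      ((hf.mono Ioo_subset_Icc_self).locallyIntegrableOn measurableSet_Ioo) fun φ hφ _ hs => ?_
    rw [← h φ hφ hs, intervalIntegral.integral_of_le hαβ.le, ← integral_indicator measurableSet_Ioc]
    refine integral_congr_ae (Eventually.of_forall fun t => ?_)
    by_cases ht : t ∈ Ioc α β
    · simp [indicator_of_mem ht, mul_comm]
    · have : φ t = 0 := image_eq_zero_of_notMem_tsupport fun h' =>
        ht (Ioo_subset_Ioc_self (hs h'))
      simp [indicator_of_notMem ht, this]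
  have h2 : EqOn f 0 (Ioo α β) := by
    refine Measure.eqOn_open_of_ae_eq (μ := volume) ?_ isOpen_Ioo
      (hf.mono Ioo_subset_Icc_self) continuousOn_const
    rwa [EventuallyEq, ae_restrict_iff' measurableSet_Ioo]
  have h3 := h2.of_subset_closure hf continuousOn_const Ioo_subset_Icc_self
    (by rw [closure_Ioo hαβ.ne])
  exact fun t ht => h3 ht

/-! ### Integrals along piecewise continuous paths. -/

section Piecewise

variable {X : Type*} [TopologicalSpace X] {t0 tf : ℝ} {J : Set ℝ} {x : ℝ → X} {K : Set X}

theorem aestronglyMeasurable_of_continuousOn_diff_finite {f : ℝ → ℝ} (hJ : J.Finite)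
    (hf : ContinuousOn f (Icc t0 tf \ J)) :
    AEStronglyMeasurable f (volume.restrict (Icc t0 tf)) := by
  have h : (volume : Measure ℝ).restrict (Icc t0 tf) = volume.restrict (Icc t0 tf \ J) :=
    (Measure.restrict_congr_set (sdiff_null_ae_eq_self (hJ.measure_zero _))).symm
  rw [h]
  exact hf.aestronglyMeasurable (measurableSet_Icc.diff hJ.measurableSet)

/-- A continuous function along a piecewise continuous path in a compact set is integrable. -/
theorem intervalIntegrable_comp_path (ht : t0 ≤ tf) (hJ : J.Finite)
    (hx : ContinuousOn x (Icc t0 tf \ J)) (hK : IsCompact K) (hxK : ∀ t ∈ Icc t0 tf, x t ∈ K)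
    {F : X → ℝ} (hF : ContinuousOn F K) :
    IntervalIntegrable (fun t => F (x t)) volume t0 tf := by
  obtain ⟨C, hC⟩ := hK.exists_bound_of_continuousOn hF
  rw [intervalIntegrable_iff_integrableOn_Icc_of_le ht]
  have hm := aestronglyMeasurable_of_continuousOn_diff_finite (f := fun t => F (x t)) hJ
    (hF.comp hx fun t h => hxK t h.1)
  refine Integrable.of_bound hm C ?_
  exact (ae_restrict_iff' measurableSet_Icc).2 (Eventually.of_forall fun t h => hC _ (hxK t h))

/-- Differentiation of an integral along a piecewise continuous path in a compact set. -/
theorem hasDerivAt_integral_comp_path (ht : t0 ≤ tf) (hJ : J.Finite)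
    (hx : ContinuousOn x (Icc t0 tf \ J)) (hK : IsCompact K) (hxK : ∀ t ∈ Icc t0 tf, x t ∈ K)
    -- Compactness of `Icc (-ε₀) ε₀ ×ˢ K` bounds `F'` by a constant, which serves as the dominating
    -- function.
    {ε₀ : ℝ} (hε₀ : 0 < ε₀) {F F' : ℝ → X → ℝ}
    (hF : ∀ ε ∈ Icc (-ε₀) ε₀, ContinuousOn (F ε) K)
    (hF' : ContinuousOn (fun y : ℝ × X => F' y.1 y.2) (Icc (-ε₀) ε₀ ×ˢ K))
    (hd : ∀ ε ∈ Icc (-ε₀) ε₀, ∀ y ∈ K, HasDerivAt (fun ε => F ε y) (F' ε y) ε) :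
    HasDerivAt (fun ε => ∫ t in t0..tf, F ε (x t)) (∫ t in t0..tf, F' 0 (x t)) 0 := by
  obtain ⟨C, hC⟩ := (isCompact_Icc.prod hK).exists_bound_of_continuousOn hF'
  have hmem : Icc (-ε₀) ε₀ ∈ 𝓝 (0 : ℝ) := Icc_mem_nhds (by linarith) hε₀
  have hint : ∀ G : X → ℝ, ContinuousOn G K →
      IntervalIntegrable (fun t => G (x t)) volume t0 tf := fun G hG =>
    intervalIntegrable_comp_path ht hJ hx hK hxK hG
  have hsub : Ι t0 tf ⊆ Icc t0 tf := by rw [uIoc_of_le ht]; exact Ioc_subset_Icc_self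
  have h0 : (0 : ℝ) ∈ Icc (-ε₀) ε₀ := mem_of_mem_nhds hmem
  refine (intervalIntegral.hasDerivAt_integral_of_dominated_loc_of_deriv_le
    (F := fun ε t => F ε (x t)) (F' := fun ε t => F' ε (x t)) (bound := fun _ => C) hmem ?_
    (hint _ (hF 0 h0)) ?_ ?_ intervalIntegrable_const ?_).2
  · filter_upwards [hmem] with ε hε
    exact (hint _ (hF ε hε)).def'.aestronglyMeasurable
  · exact (hint (F' 0) (hF'.comp (by fun_prop : ContinuousOn (fun y : X => ((0 : ℝ), y)) K)
      fun y hy => ⟨h0, hy⟩)).def'.aestronglyMeasurable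
  · exact Eventually.of_forall fun t h ε hε => hC (ε, x t) ⟨hε, hxK t (hsub h)⟩
  · exact Eventually.of_forall fun t h ε hε => hd ε hε _ (hxK t (hsub h))

end Piecewise

/-! ### Integrator paths and their perturbations. -/

variable {m : ℕ} {k : Fin m → ℕ} {c : ℕ} {t0 tf : ℝ}

theorem exists_forall_add_smul_mem {E : Type*} [NormedAddCommGroup E] [NormedSpace ℝ E]
    {K U : Set E} (hK : IsCompact K) (hU : IsOpen U) (hKU : K ⊆ U) (C : ℝ) :
    ∃ ε₀ > (0 : ℝ), ∀ ε ∈ Icc (-ε₀) ε₀, ∀ w ∈ K, ∀ v ∈ Metric.closedBall (0 : E) C, w + ε • v ∈ U := by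
  obtain ⟨δ, hδ, hδU⟩ := hK.exists_cthickening_subset_open hU hKU
  -- The denominator `|C| + 1` is positive whatever the sign of `C`, and still bounds `‖v‖`.
  refine ⟨δ / (|C| + 1), by positivity, fun ε hε w hw v hv => hδU ?_⟩
  refine Metric.mem_cthickening_of_dist_le _ w δ K hw ?_
  rw [dist_eq_norm, add_sub_cancel_left, norm_smul, Real.norm_eq_abs]
  have h1 : |ε| ≤ δ / (|C| + 1) := abs_le.2 hε
  have h2 : ‖v‖ ≤ |C| + 1 := by
    have := mem_closedBall_zero_iff.1 hv
    linarith [le_abs_self C]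
  calc |ε| * ‖v‖ ≤ δ / (|C| + 1) * (|C| + 1) := by gcongr
    _ = δ := by field_simp

theorem IsIntegratorPath.add_smul {z ζ : ℝ → Jet k} (hz : IsIntegratorPath t0 tf z)
    (hζ : IsIntegratorPath t0 tf ζ) (r : ℝ) :
    IsIntegratorPath t0 tf (fun t => z t + r • ζ t) := by
  obtain ⟨J, hJ, hJs, h1, h2, ⟨C, hC⟩, h3⟩ := hz
  obtain ⟨J', hJ', hJs', h1', h2', ⟨C', hC'⟩, h3'⟩ := hζ
  refine ⟨J ∪ J', hJ.union hJ', union_subset hJs hJs', fun q => ?_, ?_,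
    ⟨C + |r| * C', fun t ht => ?_⟩, fun q t ht => ?_⟩
  · exact (h1 q).add (continuousOn_const.mul (h1' q))
  · exact (h2.mono (sdiff_subset_sdiff_right subset_union_left)).add
      ((h2'.const_smul r).mono (sdiff_subset_sdiff_right subset_union_right))
  · refine (norm_add_le _ _).trans (add_le_add (hC t ht) ?_)
    rw [norm_smul, Real.norm_eq_abs]
    exact mul_le_mul_of_nonneg_left (hC' t ht) (abs_nonneg r)
  · exact (h3 q t ⟨ht.1, fun h => ht.2 (Or.inl h)⟩).add
      ((h3' q t ⟨ht.1, fun h => ht.2 (Or.inr h)⟩).const_mul r)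

/-- The path in the flat space whose `i`-th chain is generated by `φ`, the others being zero. -/
def jetPath (i : Fin m) (φ : ℝ → ℝ) (t : ℝ) : Jet k :=
  fun q => if q.1 = i then iteratedDeriv (q.2 : ℕ) φ t else 0

theorem jetPath_eq_zero {i : Fin m} {φ : ℝ → ℝ} {t : ℝ} (h : ∀ n, iteratedDeriv n φ t = 0) :
    (jetPath i φ t : Jet k) = 0 := by
  funext q
  simp [jetPath, h]

theorem isIntegratorPath_jetPath (i : Fin m) {φ : ℝ → ℝ} (hφ : ContDiff ℝ ∞ φ) :
    IsIntegratorPath t0 tf (jetPath i φ : ℝ → Jet k) := by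
  have hc : ∀ q : JetIdx k, Continuous fun t => (jetPath i φ t : Jet k) q := fun q => by
    unfold jetPath
    split_ifs
    · exact hφ.continuous_iteratedDeriv _ (by exact_mod_cast le_top)
    · exact continuous_const
  have hc' : Continuous (jetPath i φ : ℝ → Jet k) := continuous_pi hc
  refine ⟨∅, finite_empty, empty_subset _, fun q => (hc _).continuousOn, hc'.continuousOn,
    isCompact_Icc.exists_bound_of_continuousOn hc'.continuousOn, fun q t _ => ?_⟩
  unfold jetPath here next
  simp only [Fin.val_castSucc, Fin.val_succ]
  split_ifs
  · rw [iteratedDeriv_succ]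
    exact (hφ.differentiable_iteratedDeriv _
      (by exact_mod_cast ENat.natCast_lt_top _) t).hasDerivAt.hasDerivWithinAt
  · exact hasDerivWithinAt_const _ _ _

theorem sum_mul_single {ι : Type*} [Fintype ι] [DecidableEq ι] (L : (ι → ℝ) →L[ℝ] ℝ) (v : ι → ℝ) :
    ∑ q, L (Pi.single q 1) * v q = L v := by
  conv_rhs => rw [pi_eq_sum_univ' v, map_sum]
  refine Finset.sum_congr rfl fun q _ => ?_
  rw [map_smul, smul_eq_mul, mul_comm]

/-! ### The first variation of the augmented cost. -/

namespace Problem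

variable (Q : Problem k c)

/-- The integrand of the augmented cost. -/
def lagr (ν : Fin c → ℝ) (w : Jet k) (t : ℝ) : ℝ := Q.Psi w + ∑ l, ν l * Q.g l w t

/-- The derivative of the integrand of the augmented cost. -/
def lagrDeriv (ν : Fin c → ℝ) (w : Jet k) (t : ℝ) : Jet k →L[ℝ] ℝ :=
  fderiv ℝ Q.Psi w + ∑ l, ν l • fderiv ℝ (fun w => Q.g l w t) w

/-- The first variation of the augmented cost. -/
def firstVar (μ : ℝ → Fin c → ℝ) (z ζ : ℝ → Jet k) : ℝ :=
  fderiv ℝ Q.Phi (z Q.tf) (ζ Q.tf) + ∫ t in Q.t0..Q.tf, Q.lagrDeriv (μ t) (z t) t (ζ t)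

variable {Q}

theorem gradAlong_eq (μ : ℝ → Fin c → ℝ) (z : ℝ → Jet k) (q : JetIdx k) (t : ℝ) :
    Q.gradAlong μ z q t = Q.lagrDeriv (μ t) (z t) t (Pi.single q 1) := by
  simp [gradAlong, lagrDeriv, pderiv]

theorem lagrDeriv_apply (μ : ℝ → Fin c → ℝ) (z : ℝ → Jet k) (t : ℝ) (v : Jet k) :
    Q.lagrDeriv (μ t) (z t) t v = ∑ q, Q.gradAlong μ z q t * v q := by
  simp only [gradAlong_eq, sum_mul_single]

namespace Regular

theorem hasFDerivAt_psi (hQ : Q.Regular) {w : Jet k} (hw : w ∈ Q.Y) :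
    HasFDerivAt Q.Psi (fderiv ℝ Q.Psi w) w :=
  ((hQ.psi.differentiableOn one_ne_zero).differentiableAt (hQ.isOpen.mem_nhds hw)).hasFDerivAt

theorem hasFDerivAt_phi (hQ : Q.Regular) {w : Jet k} (hw : w ∈ Q.Y) :
    HasFDerivAt Q.Phi (fderiv ℝ Q.Phi w) w :=
  ((hQ.phi.differentiableOn one_ne_zero).differentiableAt (hQ.isOpen.mem_nhds hw)).hasFDerivAt

/-- Smoothness of `g` is joint in point and time; the partial derivative at frozen time is the joint
one restricted to the first factor, and so inherits its continuity. -/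
theorem hasFDerivAt_g_comp (hQ : Q.Regular) (l : Fin c) {w : Jet k} (hw : w ∈ Q.Y) (t : ℝ) :
    HasFDerivAt (fun w => Q.g l w t)
      ((fderiv ℝ (fun x : Jet k × ℝ => Q.g l x.1 x.2) (w, t)).comp
        (ContinuousLinearMap.inl ℝ (Jet k) ℝ)) w := by
  have h1 : HasFDerivAt (fun x : Jet k × ℝ => Q.g l x.1 x.2) _ (w, t) :=
    (((hQ.g l).differentiableOn one_ne_zero).differentiableAt
      ((hQ.isOpen.prod isOpen_univ).mem_nhds ⟨hw, mem_univ _⟩)).hasFDerivAt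
  exact HasFDerivAt.comp (f := fun e : Jet k => (e, t))
    (g := fun x : Jet k × ℝ => Q.g l x.1 x.2) w h1 (hasFDerivAt_prodMk_left w t)

theorem hasFDerivAt_g (hQ : Q.Regular) (l : Fin c) {w : Jet k} (hw : w ∈ Q.Y) (t : ℝ) :
    HasFDerivAt (fun w => Q.g l w t) (fderiv ℝ (fun w => Q.g l w t) w) w :=
  (hQ.hasFDerivAt_g_comp l hw t).differentiableAt.hasFDerivAt

theorem continuousOn_fderiv_g (hQ : Q.Regular) (l : Fin c) :
    ContinuousOn (fun x : Jet k × ℝ => fderiv ℝ (fun w => Q.g l w x.2) x.1) (Q.Y ×ˢ univ) := by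
  have h := ((hQ.g l).continuousOn_fderiv_of_isOpen (hQ.isOpen.prod isOpen_univ) le_rfl).clm_comp
    (continuousOn_const (c := ContinuousLinearMap.inl ℝ (Jet k) ℝ))
  exact h.congr fun x hx => (hQ.hasFDerivAt_g_comp l hx.1 x.2).fderiv

theorem hasFDerivAt_lagr (hQ : Q.Regular) (ν : Fin c → ℝ) {w : Jet k} (hw : w ∈ Q.Y) (t : ℝ) :
    HasFDerivAt (fun w => Q.lagr ν w t) (Q.lagrDeriv ν w t) w :=
  (hQ.hasFDerivAt_psi hw).add
    (HasFDerivAt.fun_sum fun l _ => (hQ.hasFDerivAt_g l hw t).const_mul (ν l))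

theorem continuousOn_lagr (hQ : Q.Regular) :
    ContinuousOn (fun x : Jet k × (Fin c → ℝ) × ℝ => Q.lagr x.2.1 x.1 x.2.2) (Q.Y ×ˢ univ) := by
  unfold lagr
  refine (hQ.psi.continuousOn.comp continuousOn_fst fun x hx => hx.1).add
    (continuousOn_finsetSum _ fun l _ => ?_)
  refine (by fun_prop : Continuous fun x : Jet k × (Fin c → ℝ) × ℝ => x.2.1 l).continuousOn.mul ?_
  exact (hQ.g l).continuousOn.comp
    (by fun_prop : ContinuousOn (fun x : Jet k × (Fin c → ℝ) × ℝ => (x.1, x.2.2)) _)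
    fun x hx => ⟨hx.1, mem_univ _⟩

theorem continuousOn_lagrDeriv (hQ : Q.Regular) :
    ContinuousOn (fun x : Jet k × (Fin c → ℝ) × ℝ => Q.lagrDeriv x.2.1 x.1 x.2.2)
      (Q.Y ×ˢ univ) := by
  unfold lagrDeriv
  refine ((hQ.psi.continuousOn_fderiv_of_isOpen hQ.isOpen le_rfl).comp continuousOn_fst
    fun x hx => hx.1).add (continuousOn_finsetSum _ fun l _ => ?_)
  refine (by fun_prop : Continuous fun x : Jet k × (Fin c → ℝ) × ℝ => x.2.1 l).continuousOn.smul ?_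
  exact (hQ.continuousOn_fderiv_g l).comp
    (by fun_prop : ContinuousOn (fun x : Jet k × (Fin c → ℝ) × ℝ => (x.1, x.2.2)) _)
    fun x hx => ⟨hx.1, mem_univ _⟩

end Regular

section FirstVariation

variable {z ζ : ℝ → Jet k} {μ : ℝ → Fin c → ℝ}

/-- Trajectory, variation, multiplier and time are bundled into one path in a compact product, so
that the integral lemmas apply to integrands depending on all four. -/
theorem exists_compact_path (hz : Q.IsTrajectory z) (hμ : IsPiecewise Q.t0 Q.tf μ)
    (hζ : IsIntegratorPath Q.t0 Q.tf ζ) :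
    ∃ (J : Set ℝ) (K : Set (Jet k)) (C C' : ℝ), J.Finite ∧ IsCompact K ∧ K ⊆ Q.Y ∧
      ContinuousOn (fun t => (z t, ζ t, μ t, t)) (Icc Q.t0 Q.tf \ J) ∧
      ∀ t ∈ Icc Q.t0 Q.tf, (z t, ζ t, μ t, t) ∈ K ×ˢ Metric.closedBall (0 : Jet k) C ×ˢ
        Metric.closedBall (0 : Fin c → ℝ) C' ×ˢ Icc Q.t0 Q.tf := by
  obtain ⟨⟨J₁, hJ₁, -, -, hc₁, -, -⟩, ⟨K, hK, hKY, hzK⟩, -⟩ := hz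
  obtain ⟨J₂, hJ₂, -, -, hc₂, ⟨C, hC⟩, -⟩ := hζ
  obtain ⟨J₃, hJ₃, -, hc₃, C', hC'⟩ := hμ
  refine ⟨J₁ ∪ J₂ ∪ J₃, K, C, C', (hJ₁.union hJ₂).union hJ₃, hK, hKY, ?_, fun t ht => ?_⟩
  · refine (hc₁.mono (sdiff_subset_sdiff_right ?_)).prodMk ((hc₂.mono (sdiff_subset_sdiff_right
      ?_)).prodMk ((hc₃.mono (sdiff_subset_sdiff_right ?_)).prodMk continuousOn_id))
    · exact subset_union_left.trans subset_union_left
    · exact subset_union_right.trans subset_union_left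
    · exact subset_union_right
  · exact ⟨hzK t ht, by simpa using hC t ht, by simpa using hC' t ht, ht⟩

theorem intervalIntegrable_lagrDeriv (hQ : Q.Regular) (hz : Q.IsTrajectory z)
    (hμ : IsPiecewise Q.t0 Q.tf μ) (hζ : IsIntegratorPath Q.t0 Q.tf ζ) :
    IntervalIntegrable (fun t => Q.lagrDeriv (μ t) (z t) t (ζ t)) volume Q.t0 Q.tf := by
  obtain ⟨J, K, C, C', hJ, hK, hKY, hc, hm⟩ := exists_compact_path hz hμ hζ
  refine intervalIntegrable_comp_path hQ.lt.le hJ hc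
    (hK.prod ((isCompact_closedBall _ _).prod ((isCompact_closedBall _ _).prod isCompact_Icc))) hm
    (F := fun y => Q.lagrDeriv y.2.2.1 y.1 y.2.2.2 y.2.1) ?_
  refine (hQ.continuousOn_lagrDeriv.comp (by fun_prop : ContinuousOn
    (fun y : Jet k × Jet k × (Fin c → ℝ) × ℝ => (y.1, y.2.2.1, y.2.2.2)) _)
    fun y hy => ⟨hKY hy.1, mem_univ _⟩).clm_apply (by fun_prop)

theorem intervalIntegrable_lagr (hQ : Q.Regular) (hz : Q.IsTrajectory z)
    (hμ : IsPiecewise Q.t0 Q.tf μ) :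
    IntervalIntegrable (fun t => Q.lagr (μ t) (z t) t) volume Q.t0 Q.tf := by
  obtain ⟨J, K, C, C', hJ, hK, hKY, hc, hm⟩ := exists_compact_path hz hμ hz.1
  refine intervalIntegrable_comp_path hQ.lt.le hJ hc
    (hK.prod ((isCompact_closedBall _ _).prod ((isCompact_closedBall _ _).prod isCompact_Icc))) hm
    (F := fun y => Q.lagr y.2.2.1 y.1 y.2.2.2) ?_
  exact hQ.continuousOn_lagr.comp (by fun_prop : ContinuousOn
    (fun y : Jet k × Jet k × (Fin c → ℝ) × ℝ => (y.1, y.2.2.1, y.2.2.2)) _)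
    fun y hy => ⟨hKY hy.1, mem_univ _⟩

theorem hasDerivAt_augCost (hQ : Q.Regular) (hz : Q.IsTrajectory z)
    (hμ : IsPiecewise Q.t0 Q.tf μ) (hζ : IsIntegratorPath Q.t0 Q.tf ζ) :
    HasDerivAt (fun ε : ℝ => Q.augCost μ (fun t => z t + ε • ζ t)) (Q.firstVar μ z ζ) 0 := by
  obtain ⟨J, K, C, C', hJ, hK, hKY, hc, hm⟩ := exists_compact_path hz hμ hζ
  obtain ⟨ε₀, hε₀, hY⟩ := exists_forall_add_smul_mem hK hQ.isOpen hKY C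
  have hline : ∀ (w v : Jet k) (ε : ℝ), HasDerivAt (fun ε : ℝ => w + ε • v) v ε := fun w v ε => by
    simpa using ((hasDerivAt_id ε).smul_const v).const_add w
  have hint := hasDerivAt_integral_comp_path hQ.lt.le hJ hc
    (hK.prod ((isCompact_closedBall _ _).prod ((isCompact_closedBall _ _).prod isCompact_Icc))) hm
    hε₀ (F := fun ε y => Q.lagr y.2.2.1 (y.1 + ε • y.2.1) y.2.2.2)
    (F' := fun ε y => Q.lagrDeriv y.2.2.1 (y.1 + ε • y.2.1) y.2.2.2 y.2.1)
    (fun ε hε => hQ.continuousOn_lagr.comp (by fun_prop : ContinuousOn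
      (fun y : Jet k × Jet k × (Fin c → ℝ) × ℝ => (y.1 + ε • y.2.1, y.2.2.1, y.2.2.2)) _)
      fun y hy => ⟨hY ε hε _ hy.1 _ hy.2.1, mem_univ _⟩)
    ((hQ.continuousOn_lagrDeriv.comp (by fun_prop : ContinuousOn
      (fun y : ℝ × Jet k × Jet k × (Fin c → ℝ) × ℝ =>
        (y.2.1 + y.1 • y.2.2.1, y.2.2.2.1, y.2.2.2.2)) _)
      fun y hy => ⟨hY _ hy.1 _ hy.2.1 _ hy.2.2.1, mem_univ _⟩).clm_apply (by fun_prop))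
    (fun ε hε y hy => HasFDerivAt.comp_hasDerivAt (f := fun ε : ℝ => y.1 + ε • y.2.1) ε
      (hQ.hasFDerivAt_lagr y.2.2.1 (hY ε hε _ hy.1 _ hy.2.1) y.2.2.2) (hline y.1 y.2.1 ε))
  simp only [zero_smul, add_zero] at hint
  have htf : z Q.tf + (0 : ℝ) • ζ Q.tf ∈ Q.Y := by
    simpa using hKY (hm Q.tf ⟨hQ.lt.le, le_rfl⟩).1
  have hphi := HasFDerivAt.comp_hasDerivAt (f := fun ε : ℝ => z Q.tf + ε • ζ Q.tf) 0
    (hQ.hasFDerivAt_phi htf) (hline (z Q.tf) (ζ Q.tf) 0)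
  simp only [zero_smul, add_zero] at hphi
  exact hphi.add hint

theorem firstVar_add_smul (hQ : Q.Regular) (hz : Q.IsTrajectory z)
    (hμ : IsPiecewise Q.t0 Q.tf μ) (hζ : IsIntegratorPath Q.t0 Q.tf ζ) {η : ℝ → Jet k}
    (hη : IsIntegratorPath Q.t0 Q.tf η) (r : ℝ) :
    Q.firstVar μ z (fun t => ζ t + r • η t) = Q.firstVar μ z ζ + r * Q.firstVar μ z η := by
  unfold firstVar
  simp only [map_add, map_smul, smul_eq_mul]
  rw [intervalIntegral.integral_add (intervalIntegrable_lagrDeriv hQ hz hμ hζ)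
    ((intervalIntegrable_lagrDeriv hQ hz hμ hη).const_mul r), intervalIntegral.integral_const_mul]
  ring

theorem isStationary_iff (hQ : Q.Regular) (hz : Q.IsTrajectory z)
    (hμ : IsPiecewise Q.t0 Q.tf μ) :
    Q.IsStationary μ z ↔ ∀ ζ : ℝ → Jet k, IsIntegratorPath Q.t0 Q.tf ζ →
      Q.bd ζ ∈ tangentConeAt ℝ Q.B (Q.bd z) → Q.firstVar μ z ζ = 0 :=
  forall_congr' fun _ => forall_congr' fun hζ => forall_congr' fun _ =>
    ⟨fun h => (hasDerivAt_augCost hQ hz hμ hζ).unique h,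
      fun h => h ▸ hasDerivAt_augCost hQ hz hμ hζ⟩

/-- `fixAt` alters only `B`, which the augmented cost does not involve, so both problems share one
first variation. -/
theorem isStationary_fixAt_iff (hQ : Q.Regular) (hz : Q.IsTrajectory z)
    (hμ : IsPiecewise Q.t0 Q.tf μ) (b : Endpoint) (p : StateIdx k) (r : ℝ) :
    (Q.fixAt b p r).IsStationary μ z ↔ ∀ ζ : ℝ → Jet k, IsIntegratorPath Q.t0 Q.tf ζ →
      Q.bd ζ ∈ tangentConeAt ℝ (Q.B ∩ {β | β b p = r}) (Q.bd z) → Q.firstVar μ z ζ = 0 := by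
  refine forall_congr' fun ζ => forall_congr' fun hζ => forall_congr' fun _ => ?_
  have hd : HasDerivAt (fun ε : ℝ => (Q.fixAt b p r).augCost μ (fun t => z t + ε • ζ t))
    (Q.firstVar μ z ζ) 0 :=
    hasDerivAt_augCost (Q := Q) hQ hz hμ hζ
  exact ⟨fun h => hd.unique h, fun h => h ▸ hd⟩

end FirstVariation

end Problem

/-! ### Costates as Euler sums. -/

/-- The costate that precedes the coordinate `y_i^{(n)}` in its chain, zero out of range. -/
def prevCostate (lam : StateIdx k → ℝ) (i : Fin m) : ℕ → ℝ
  | 0 => 0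
  | n + 1 => if h : n < k i then lam ⟨i, ⟨n, h⟩⟩ else 0

theorem prevCostate_succ (lam : StateIdx k → ℝ) {i : Fin m} {n : ℕ} (h : n < k i) :
    prevCostate lam i (n + 1) = lam ⟨i, ⟨n, h⟩⟩ := dif_pos h

theorem next_injective : Function.Injective (next : StateIdx k → JetIdx k) := by
  rintro ⟨i, j⟩ ⟨i', j'⟩ h
  simp only [next, Sigma.mk.injEq] at h
  obtain ⟨rfl, h⟩ := h
  simpa using h

theorem sum_mul_single_next (lam : StateIdx k → ℝ) (q : JetIdx k) :
    ∑ p, lam p * (Pi.single q 1 : Jet k) (next p) = prevCostate lam q.1 q.2 := by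
  obtain ⟨i, n, hn⟩ := q
  cases n with
  | zero =>
    refine Finset.sum_eq_zero fun p _ => ?_
    have : next p ≠ ⟨i, ⟨0, hn⟩⟩ := by
      rintro h
      have h' := congrArg (fun q : JetIdx k => (q.2 : ℕ)) h
      simp [next] at h'
    rw [Pi.single_eq_of_ne this, mul_zero]
  | succ n =>
    have hn' : n < k i := by omega
    have hq : (⟨i, ⟨n + 1, hn⟩⟩ : JetIdx k) = next ⟨i, ⟨n, hn'⟩⟩ := rfl
    rw [Finset.sum_eq_single ⟨i, ⟨n, hn'⟩⟩]
    · simp [hq, prevCostate, hn']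
    · intro p _ hp
      rw [hq, Pi.single_eq_of_ne (next_injective.ne hp), mul_zero]
    · simp

/-- The variation of the boundary values that moves the state `p` at the endpoint `b`. -/
def bdUnit (b : Endpoint) (p : StateIdx k) : Endpoint → StateIdx k → ℝ :=
  Pi.single b (Pi.single p 1)

theorem add_smul_bdUnit (β : Endpoint → StateIdx k → ℝ) (b : Endpoint) (p : StateIdx k) (r : ℝ) :
    β + r • bdUnit b p = Function.update β b (Function.update (β b) p (β b p + r)) := by
  funext b' p'
  by_cases hb : b' = b
  · subst hb
    by_cases hp : p' = p
    · subst hp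
      simp [bdUnit]
    · simp [bdUnit, hp]
  · simp [bdUnit, hb]

namespace Problem

variable {Q : Problem k c} {z : ℝ → Jet k} {μ : ℝ → Fin c → ℝ}

theorem pderiv_hamiltonian (hQ : Q.Regular) (lam : StateIdx k → ℝ) {t : ℝ} (hw : z t ∈ Q.Y)
    (q : JetIdx k) : pderiv (fun w => Q.hamiltonian lam (μ t) w t) q (z t) =
      Q.gradAlong μ z q t + prevCostate lam q.1 q.2 := by
  have h1 : HasFDerivAt (fun w : Jet k => ∑ p, lam p * w (next p))
      (∑ p, lam p • ContinuousLinearMap.proj (R := ℝ) (φ := fun _ : JetIdx k => ℝ) (next p))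
      (z t) :=
    HasFDerivAt.fun_sum fun p _ => (hasFDerivAt_apply (next p) (z t)).const_mul (lam p)
  have h2 := (hQ.hasFDerivAt_lagr (μ t) hw t).add h1
  have h3 : (fun w => Q.hamiltonian lam (μ t) w t) =
      (fun w => Q.lagr (μ t) w t) + fun w : Jet k => ∑ p, lam p * w (next p) := by
    funext w
    simp only [hamiltonian, lagr, Pi.add_apply]
    ring
  rw [pderiv, h3, h2.fderiv, gradAlong_eq, ← sum_mul_single_next]
  simp

variable (Q) in
/-- The functions `Ψ_{y_i^{(n)}} + μᵀ g_{y_i^{(n)}}` of the `i`-th chain, zero out of range. -/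
def chainGrad (μ : ℝ → Fin c → ℝ) (z : ℝ → Jet k) (i : Fin m) (n : ℕ) (t : ℝ) : ℝ :=
  if h : n < k i + 1 then Q.gradAlong μ z ⟨i, ⟨n, h⟩⟩ t else 0

theorem chainGrad_of_lt {i : Fin m} {n : ℕ} (h : n < k i + 1) :
    Q.chainGrad μ z i n = Q.gradAlong μ z ⟨i, ⟨n, h⟩⟩ := by
  funext t
  simp [chainGrad, h]

theorem contDiffOn_chainGrad {S : Set ℝ}
    (hsmooth : ∀ q : JetIdx k, ContDiffOn ℝ (q.2 : ℕ) (Q.gradAlong μ z q) S) (i : Fin m) (n : ℕ)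
    (hn : n ≤ k i) : ContDiffOn ℝ n (Q.chainGrad μ z i n) S := by
  rw [chainGrad_of_lt (Nat.lt_succ_of_le hn)]
  exact hsmooth ⟨i, ⟨n, Nat.lt_succ_of_le hn⟩⟩

theorem costateFree_eq (S : Set ℝ) (p : StateIdx k) (t : ℝ) :
    Q.costateFree S μ z p t = -altSum S (Q.chainGrad μ z p.1) (k p.1) (p.2 + 1) t := by
  have h := Fin.sum_univ_eq_sum_range (fun n => (-1 : ℝ) ^ (n + 1) *
    iteratedDerivWithin n (Q.chainGrad μ z p.1 ((p.2 : ℕ) + (n + 1))) S t) (k p.1 - p.2)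
  rw [altSum, ← Finset.sum_neg_distrib, Nat.add_sub_add_right, costateFree]
  refine (Finset.sum_congr rfl fun n _ => ?_).trans (h.trans (Finset.sum_congr rfl fun n _ => ?_))
  · rw [chainGrad_of_lt]
  · rw [(by omega : (p.2 : ℕ) + (n + 1) = p.2 + 1 + n)]
    ring

/-- The costate equations, chain by chain. -/
theorem isCostateOn_iff (hQ : Q.Regular) {S : Set ℝ} (hS : UniqueDiffOn ℝ S)
    (hzS : ∀ t ∈ S, z t ∈ Q.Y) (lam : ℝ → StateIdx k → ℝ) :
    Q.IsCostateOn S μ z lam ↔ ∀ t ∈ S, ∀ (i : Fin m) (n : ℕ), n ≤ k i →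
      HasDerivWithinAt (fun τ => prevCostate (lam τ) i (n + 1))
        (-(Q.chainGrad μ z i n t + prevCostate (lam t) i n)) S t := by
  -- At `n = k i` the differentiated function is constantly zero, so the uniform equation there is
  -- the algebraic condition `0 = H_a`.
  have hlast : ∀ i, (fun τ => prevCostate (lam τ) i (k i + 1)) = fun _ => 0 := fun i => by
    funext τ
    simp [prevCostate]
  refine forall_congr' fun t => forall_congr' fun ht => ?_
  simp only [pderiv_hamiltonian hQ _ (hzS t ht)]
  constructor
  · rintro ⟨h1, h2⟩ i n hn
    rcases hn.lt_or_eq with hn | rfl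
    · have h := h1 ⟨i, ⟨n, hn⟩⟩
      rw [chainGrad_of_lt (by omega)]
      simp only [prevCostate_succ _ hn]
      exact h
    · rw [hlast, chainGrad_of_lt (by omega)]
      have h := h2 i
      simp only [top, Fin.val_last] at h
      rw [show (⟨k i, Nat.lt_succ_self _⟩ : Fin (k i + 1)) = Fin.last _ from rfl, h, neg_zero]
      exact hasDerivWithinAt_const _ _ _
  · intro h
    refine ⟨fun p => ?_, fun i => ?_⟩
    · have h' := h p.1 p.2 p.2.2.le
      rw [chainGrad_of_lt (by omega)] at h'
      simp only [prevCostate_succ _ p.2.2] at h'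
      exact h'
    · have h' := h i (k i) le_rfl
      rw [hlast, chainGrad_of_lt (by omega)] at h'
      have h'' := (hS t ht).eq_deriv S h' (hasDerivWithinAt_const _ _ _)
      simp only [top, Fin.val_last]
      exact neg_eq_zero.1 h''

/-- Uniqueness of derivatives lets each equation determine the preceding costate from the following
one; the induction descends from the zero value beyond the control, `d` being the distance to it. -/
theorem costate_eq_costateFree {S : Set ℝ} (hQ : Q.Regular) (hS : UniqueDiffOn ℝ S)
    (hzS : ∀ t ∈ S, z t ∈ Q.Y)
    (hsmooth : ∀ q : JetIdx k, ContDiffOn ℝ (q.2 : ℕ) (Q.gradAlong μ z q) S)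
    {lam : ℝ → StateIdx k → ℝ} (h : Q.IsCostateOn S μ z lam)
    (p : StateIdx k) {t : ℝ} (ht : t ∈ S) : lam t p = Q.costateFree S μ z p t := by
  rw [isCostateOn_iff hQ hS hzS] at h
  have key : ∀ d n, n + d = k p.1 + 1 → ∀ t ∈ S,
      prevCostate (lam t) p.1 n = -altSum S (Q.chainGrad μ z p.1) (k p.1) n t := by
    intro d
    induction d with
    | zero =>
      rintro n hn t -
      obtain rfl : n = k p.1 + 1 := by omega
      simp [prevCostate, altSum_of_lt]
    | succ d ih =>
      intro n hn t ht
      have h1 := h t ht p.1 n (by omega)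
      have h2 := (hasDerivWithinAt_altSum hS (contDiffOn_chainGrad hsmooth p.1)
        (by omega : n ≤ k p.1) ht).fun_neg
      have h3 := (hS t ht).eq_deriv S h1
        (h2.congr (fun τ hτ => ih (n + 1) (by omega) τ hτ) (ih (n + 1) (by omega) t ht))
      linarith
  have h4 := key (k p.1 - p.2) (p.2 + 1) (by have := p.2.2; omega) t ht
  rw [costateFree_eq, ← h4]
  simp [prevCostate]

/-- The negated Euler sums solve the recursion by construction. Only its start needs the
Euler-Lagrange equation: nothing precedes `y_i`, so the sum of index zero has to vanish. -/
theorem exists_isCostateOn {S : Set ℝ} (hQ : Q.Regular) (hS : UniqueDiffOn ℝ S)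
    (hzS : ∀ t ∈ S, z t ∈ Q.Y)
    (hsmooth : ∀ q : JetIdx k, ContDiffOn ℝ (q.2 : ℕ) (Q.gradAlong μ z q) S)
    (hEL : ∀ i, ∀ t ∈ S, altSum S (Q.chainGrad μ z i) (k i) 0 t = 0) :
    ∃ lam : ℝ → StateIdx k → ℝ, Q.IsCostateOn S μ z lam := by
  refine ⟨fun t p => Q.costateFree S μ z p t, ?_⟩
  rw [isCostateOn_iff hQ hS hzS]
  have key : ∀ t ∈ S, ∀ i n, prevCostate (fun p => Q.costateFree S μ z p t) i n =
      -altSum S (Q.chainGrad μ z i) (k i) n t := by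
    intro t ht i n
    cases n with
    | zero => simp [prevCostate, hEL i t ht]
    | succ n =>
      by_cases hn : n < k i
      · simp [prevCostate, hn, costateFree_eq]
      · simp [prevCostate, hn, altSum_of_lt (by omega : k i < n + 1)]
  intro t ht i n hn
  refine ((hasDerivWithinAt_altSum hS (contDiffOn_chainGrad hsmooth i) hn ht).fun_neg.congr
    (fun τ hτ => key τ hτ i (n + 1)) (key t ht i (n + 1))).congr_deriv ?_
  rw [key t ht i n]
  ring

/-! ### Variations along a single chain. -/

theorem lagrDeriv_jetPath (i : Fin m) (φ : ℝ → ℝ) (t : ℝ) :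
    Q.lagrDeriv (μ t) (z t) t (jetPath i φ t) =
      ∑ n ∈ Finset.range (k i + 1), Q.chainGrad μ z i n t * iteratedDeriv n φ t := by
  rw [lagrDeriv_apply, Fintype.sum_sigma, Finset.sum_eq_single i]
  · rw [← Fin.sum_univ_eq_sum_range (fun n => Q.chainGrad μ z i n t * iteratedDeriv n φ t)]
    refine Finset.sum_congr rfl fun n _ => ?_
    rw [chainGrad_of_lt n.2]
    simp [jetPath]
  · intro i' _ hi
    refine Finset.sum_eq_zero fun n _ => ?_
    simp [jetPath, hi]
  · simp

theorem firstVar_jetPath {α β : ℝ} (hαβ : α < β) (hα : Q.t0 ≤ α) (hβ : β ≤ Q.tf)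
    (hsmooth : ∀ q : JetIdx k, ContDiffOn ℝ (q.2 : ℕ) (Q.gradAlong μ z q) (Icc α β))
    (i : Fin m) {φ : ℝ → ℝ} (hφ : ContDiff ℝ ∞ φ)
    (hoff : ∀ t ∈ Icc Q.t0 Q.tf, t ∉ Icc α β → ∀ n, iteratedDeriv n φ t = 0) :
    Q.firstVar μ z (jetPath i φ) = fderiv ℝ Q.Phi (z Q.tf) (jetPath i φ Q.tf) +
      ((∫ t in α..β, altSum (Icc α β) (Q.chainGrad μ z i) (k i) 0 t * φ t) +
        ((∑ n ∈ Finset.range (k i + 1), altSum (Icc α β) (Q.chainGrad μ z i) (k i) (n + 1) β *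
            iteratedDeriv n φ β) -
          ∑ n ∈ Finset.range (k i + 1), altSum (Icc α β) (Q.chainGrad μ z i) (k i) (n + 1) α *
            iteratedDeriv n φ α)) := by
  rw [firstVar, ← integral_sum_mul_iteratedDeriv hαβ (contDiffOn_chainGrad hsmooth i) hφ]
  simp only [lagrDeriv_jetPath]
  rw [intervalIntegral.integral_of_le hαβ.le, intervalIntegral.integral_of_le
    (hα.trans (hαβ.le.trans hβ)), ← integral_Icc_eq_integral_Ioc, ← integral_Icc_eq_integral_Ioc]
  congr 1
  refine setIntegral_eq_of_subset_of_forall_sdiff_eq_zero measurableSet_Icc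
    (Icc_subset_Icc hα hβ) fun t ht => ?_
  exact Finset.sum_eq_zero fun n _ => by rw [hoff t ht.1 ht.2 n, mul_zero]

/-- The Euler-Lagrange equation on an arc. -/
theorem altSum_zero_eq_zero {α β : ℝ} (hαβ : α < β) (hα : Q.t0 ≤ α) (hβ : β ≤ Q.tf)
    (hsmooth : ∀ q : JetIdx k, ContDiffOn ℝ (q.2 : ℕ) (Q.gradAlong μ z q) (Icc α β))
    (i : Fin m)
    (h : ∀ φ : ℝ → ℝ, ContDiff ℝ ∞ φ →
      (∀ t ∈ Icc Q.t0 Q.tf, t ∉ Icc α β → ∀ n, iteratedDeriv n φ t = 0) →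
      Q.bd (jetPath i φ) = 0 → Q.firstVar μ z (jetPath i φ) = 0) :
    ∀ t ∈ Icc α β, altSum (Icc α β) (Q.chainGrad μ z i) (k i) 0 t = 0 := by
  refine eqOn_zero_of_integral_mul_eq_zero hαβ (continuousOn_altSum (uniqueDiffOn_Icc hαβ)
    (contDiffOn_chainGrad hsmooth i) 0) fun φ hφ hs => ?_
  -- Support inside the open interval kills every derivative at both ends, hence the boundary terms
  -- and the variation of `Φ`.
  have h0 : ∀ t ∉ Ioo α β, ∀ n, iteratedDeriv n φ t = 0 := fun t ht n => by
    rw [(notMem_tsupport_iff_eventuallyEq.1 fun h' => ht (hs h')).iteratedDeriv_eq]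
    change iteratedDeriv n (fun _ => (0 : ℝ)) t = 0
    simp
  have hoff : ∀ t ∈ Icc Q.t0 Q.tf, t ∉ Icc α β → ∀ n, iteratedDeriv n φ t = 0 :=
    fun t _ ht => h0 t fun h' => ht (Ioo_subset_Icc_self h')
  have htf : (jetPath i φ Q.tf : Jet k) = 0 := jetPath_eq_zero (h0 _ fun h' => hβ.not_gt h'.2)
  have ht0 : (jetPath i φ Q.t0 : Jet k) = 0 := jetPath_eq_zero (h0 _ fun h' => hα.not_gt h'.1)
  have hbd : Q.bd (jetPath i φ) = 0 := by
    funext b q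
    cases b
    · simp [bd, time, ht0]
    · simp [bd, time, htf]
  have h1 := h φ hφ hoff hbd
  rw [firstVar_jetPath hαβ hα hβ hsmooth i hφ hoff, htf] at h1
  simpa [h0 α (by simp), h0 β (by simp)] using h1

theorem exists_arc_eq {b : Endpoint} {t1 : ℝ} (ht1 : t1 ∈ Ioo Q.t0 Q.tf) :
    ∃ α β, α < β ∧ Q.t0 ≤ α ∧ β ≤ Q.tf ∧ Q.arc b t1 = Icc α β ∧
      (b = .initial ∧ α = Q.t0 ∧ β = t1 ∨ b = .final ∧ α = t1 ∧ β = Q.tf) := by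
  cases b
  · exact ⟨Q.t0, t1, ht1.1, le_rfl, ht1.2.le, rfl, by simp⟩
  · exact ⟨t1, Q.tf, ht1.2, ht1.1.le, le_rfl, rfl, by simp⟩

/-- A variation supported on the arc that moves the state `p` at the endpoint `b`. -/
theorem exists_variation (b : Endpoint) (p : StateIdx k)
    (hPhi : b = .final → pderiv Q.Phi (here p) (z Q.tf) = 0) {t1 : ℝ}
    (ht1 : t1 ∈ Ioo Q.t0 Q.tf)
    (hsmooth : ∀ q : JetIdx k, ContDiffOn ℝ (q.2 : ℕ) (Q.gradAlong μ z q) (Q.arc b t1)) :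
    ∃ φ : ℝ → ℝ, ContDiff ℝ ∞ φ ∧
      (∀ t ∈ Icc Q.t0 Q.tf, t ∉ Q.arc b t1 → ∀ n, iteratedDeriv n φ t = 0) ∧
      Q.bd (jetPath p.1 φ) = bdUnit b p ∧
      ((∀ t ∈ Q.arc b t1, altSum (Q.arc b t1) (Q.chainGrad μ z p.1) (k p.1) 0 t = 0) →
        (Q.firstVar μ z (jetPath p.1 φ) = 0 ↔
          Q.costateFree (Q.arc b t1) μ z p (Q.time b) = 0)) := by
  obtain ⟨α, β, hαβ, hα, hβ, harc, hb⟩ := exists_arc_eq (b := b) ht1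
  rw [harc] at hsmooth ⊢
  have hj : (p.2 : ℕ) ∈ Finset.range (k p.1 + 1) := Finset.mem_range.2 (by omega)
  have hint : (∀ t ∈ Icc α β, altSum (Icc α β) (Q.chainGrad μ z p.1) (k p.1) 0 t = 0) →
      ∀ φ : ℝ → ℝ,
      ∫ t in α..β, altSum (Icc α β) (Q.chainGrad μ z p.1) (k p.1) 0 t * φ t = 0 := by
    intro hE φ
    rw [intervalIntegral.integral_congr (g := fun _ => (0 : ℝ)), intervalIntegral.integral_zero]
    intro t ht
    rw [uIcc_of_le hαβ.le] at ht
    simp [hE t ht]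
  have hunit : ∀ (φ : ℝ → ℝ) (a : ℝ), (∀ n, iteratedDeriv n φ a = if n = p.2 then 1 else 0) →
      (jetPath p.1 φ a : Jet k) = Pi.single (here p) 1 := by
    intro φ a h
    funext q
    obtain ⟨i, n⟩ := q
    simp only [jetPath, h]
    by_cases hi : i = p.1
    · subst hi
      by_cases hn : n = p.2.castSucc
      · subst hn
        simp [here]
      · have h1 : (n : ℕ) ≠ p.2 := fun h' => hn (Fin.ext h')
        have h2 : (⟨p.1, n⟩ : JetIdx k) ≠ here p := fun h' => hn (by simpa [here] using h')
        simp [h1, Pi.single_eq_of_ne h2]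
    · have h2 : (⟨i, n⟩ : JetIdx k) ≠ here p := fun h' => hi (congrArg Sigma.fst h')
      simp [hi, Pi.single_eq_of_ne h2]
  have here_inj : Function.Injective (here : StateIdx k → JetIdx k) := by
    rintro ⟨i, j⟩ ⟨i', j'⟩ h
    simp only [here, Sigma.mk.injEq] at h
    obtain ⟨rfl, h⟩ := h
    simpa using h
  have hsingle : ∀ q : StateIdx k, (Pi.single (here p) 1 : Jet k) (here q) =
      (Pi.single p 1 : StateIdx k → ℝ) q := by
    intro q
    by_cases hq : q = p
    · simp [hq]
    · rw [Pi.single_eq_of_ne hq, Pi.single_eq_of_ne (here_inj.ne hq)]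
  rcases hb with ⟨rfl, rfl, rfl⟩ | ⟨rfl, rfl, rfl⟩
  -- The radius is the length of the arc, so the variation has died out, with all derivatives, at
  -- the other end of the arc.
  · obtain ⟨φ, hφ, h0, h1⟩ := exists_contDiff_iteratedDeriv_eq Q.t0 (sub_pos.2 hαβ) p.2
    have hfar : ∀ t, β ≤ t → ∀ n, iteratedDeriv n φ t = 0 := fun t ht n =>
      h0 n t (by rw [abs_of_nonneg (by linarith)]; linarith)
    have hoff : ∀ t ∈ Icc Q.t0 Q.tf, t ∉ Icc Q.t0 β → ∀ n, iteratedDeriv n φ t = 0 :=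
      fun t ht ht' => hfar t (not_lt.1 fun h => ht' ⟨ht.1, h.le⟩)
    have htf : (jetPath p.1 φ Q.tf : Jet k) = 0 := jetPath_eq_zero (hfar _ hβ)
    refine ⟨φ, hφ, hoff, ?_, fun hE => ?_⟩
    · funext b q
      cases b
      · simp only [bd, time, hunit φ _ h1, hsingle, bdUnit, Pi.single_eq_same]
      · simp [bd, time, htf, bdUnit]
    · rw [firstVar_jetPath hαβ hα hβ hsmooth p.1 hφ hoff, hint hE, htf, costateFree_eq]
      simp [hfar β le_rfl, h1, time]
  · obtain ⟨φ, hφ, h0, h1⟩ := exists_contDiff_iteratedDeriv_eq Q.tf (sub_pos.2 hαβ) p.2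
    have hfar : ∀ t, t ≤ α → ∀ n, iteratedDeriv n φ t = 0 := fun t ht n =>
      h0 n t (by rw [abs_of_nonpos (by linarith)]; linarith)
    have hoff : ∀ t ∈ Icc Q.t0 Q.tf, t ∉ Icc α Q.tf → ∀ n, iteratedDeriv n φ t = 0 :=
      fun t ht ht' => hfar t (not_lt.1 fun h => ht' ⟨h.le, ht.2⟩)
    have ht0 : (jetPath p.1 φ Q.t0 : Jet k) = 0 := jetPath_eq_zero (hfar _ hα)
    refine ⟨φ, hφ, hoff, ?_, fun hE => ?_⟩
    · funext b q
      cases b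
      · simp [bd, time, ht0, bdUnit]
      · simp only [bd, time, hunit φ _ h1, hsingle, bdUnit, Pi.single_eq_same]
    -- At the final time the variation moves only the coordinate `here p`, to which `Φ` is
    -- insensitive to first order.
    · have hΦ : fderiv ℝ Q.Phi (z Q.tf) (Pi.single (here p) 1) = 0 := hPhi rfl
      rw [firstVar_jetPath hαβ hα hβ hsmooth p.1 hφ hoff, hint hE, hunit φ _ h1, hΦ,
        costateFree_eq]
      simp [hfar α le_rfl, h1, time]

end Problem

/-! ### Convexity, free boundary values and optimality. -/

/-- The gradient inequality of a convex function. -/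
theorem fderiv_sub_le_of_convexOn {E : Type*} [NormedAddCommGroup E] [NormedSpace ℝ E]
    {U : Set E} {f : E → ℝ} {f' : E →L[ℝ] ℝ} (hf : ConvexOn ℝ U f) {x y : E} (hx : x ∈ U)
    (hy : y ∈ U) (hd : HasFDerivAt f f' x) : f' (y - x) ≤ f y - f x := by
  have hline : HasDerivAt (fun ε : ℝ => x + ε • (y - x)) (y - x) 0 := by
    simpa using ((hasDerivAt_id (0 : ℝ)).smul_const (y - x)).const_add x
  have h1 : HasDerivAt (fun ε : ℝ => f (x + ε • (y - x))) (f' (y - x)) 0 := by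
    refine HasFDerivAt.comp_hasDerivAt (f := fun ε : ℝ => x + ε • (y - x)) 0 ?_ hline
    simpa using hd
  have h2 := hasDerivAt_iff_tendsto_slope_zero.1 h1
  have h3 : Tendsto (fun ε : ℝ => ε⁻¹ • (f (x + (0 + ε) • (y - x)) - f (x + (0 : ℝ) • (y - x))))
      (𝓝[>] 0) (𝓝 (f' (y - x))) := h2.mono_left (nhdsWithin_mono _ fun ε hε => ne_of_gt hε)
  refine le_of_tendsto h3 ?_
  filter_upwards [Ioo_mem_nhdsGT (zero_lt_one' ℝ)] with ε hε
  have h4 := hf.2 hx hy (sub_nonneg.2 hε.2.le) hε.1.le (by ring)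
  have h5 : x + (0 + ε) • (y - x) = (1 - ε) • x + ε • y := by
    rw [zero_add, smul_sub, sub_smul, one_smul]; abel
  rw [h5, zero_smul, add_zero, smul_eq_mul, inv_mul_le_iff₀ hε.1]
  simp only [smul_eq_mul] at h4
  linarith

namespace Problem

variable {Q : Problem k c} {z : ℝ → Jet k} {μ : ℝ → Fin c → ℝ} {b : Endpoint} {p : StateIdx k}

theorem IsFree.add_smul_mem (hfree : Q.IsFree b p) {β : Endpoint → StateIdx k → ℝ} (hβ : β ∈ Q.B)
    (r : ℝ) : β + r • bdUnit b p ∈ Q.B := by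
  rw [add_smul_bdUnit]
  exact hfree β hβ _

theorem IsFree.bdUnit_mem_tangentConeAt (hfree : Q.IsFree b p) {β : Endpoint → StateIdx k → ℝ}
    (hβ : β ∈ Q.B) : bdUnit b p ∈ tangentConeAt ℝ Q.B β := by
  have h : segment ℝ β (β + bdUnit b p) ⊆ Q.B := by
    rw [segment_eq_image']
    rintro _ ⟨r, -, rfl⟩
    simpa using hfree.add_smul_mem hβ r
  simpa using mem_tangentConeAt_of_segment_subset h

/-- The linear projection `π` along `bdUnit b p` erases the component `p` at `b`. Freeness keeps
projected displacements admissible, so `π` carries a sequence defining a tangent vector of `B` to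
one for the restricted set. -/
theorem IsFree.sub_smul_mem_tangentConeAt (hfree : Q.IsFree b p)
    {β v : Endpoint → StateIdx k → ℝ} (hv : v ∈ tangentConeAt ℝ Q.B β) :
    v + (-v b p) • bdUnit b p ∈ tangentConeAt ℝ (Q.B ∩ {β' | β' b p = β b p}) β := by
  let ev : (Endpoint → StateIdx k → ℝ) →L[ℝ] ℝ :=
    (ContinuousLinearMap.proj p).comp
      (ContinuousLinearMap.proj (R := ℝ) (φ := fun _ : Endpoint => StateIdx k → ℝ) b)
  let π : (Endpoint → StateIdx k → ℝ) →L[ℝ] (Endpoint → StateIdx k → ℝ) :=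
    ContinuousLinearMap.id ℝ _ + (-ev).smulRight (bdUnit b p)
  have hπ : ∀ x, π x = x + (-x b p) • bdUnit b p := fun x => rfl
  obtain ⟨ι, l, hl, a, d, hd, hdB, hav⟩ := exists_fun_of_mem_tangentConeAt hv
  rw [← hπ]
  refine mem_tangentConeAt_of_seq l a (fun n => π (d n)) ?_ ?_ ?_
  · simpa [Function.comp_def] using (π.continuous.tendsto 0).comp hd
  · filter_upwards [hdB] with n hn
    have h : β + π (d n) = β + d n + (-d n b p) • bdUnit b p := by rw [hπ, add_assoc]
    rw [h]
    exact ⟨hfree.add_smul_mem hn _, by simp [bdUnit]⟩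
  · simpa [Function.comp_def] using (π.continuous.tendsto v).comp hav

theorem IsTrajectory.mem_Y (hz : Q.IsTrajectory z) {t : ℝ} (ht : t ∈ Icc Q.t0 Q.tf) :
    z t ∈ Q.Y := by
  obtain ⟨-, ⟨K, -, hKY, hK⟩, -⟩ := hz
  exact hKY (hK t ht)

theorem cost_eq_augCost_zero (w : ℝ → Jet k) : Q.cost w = Q.augCost 0 w := by
  simp [cost, augCost]

theorem isPiecewise_zero : IsPiecewise Q.t0 Q.tf (0 : ℝ → Fin c → ℝ) :=
  ⟨∅, finite_empty, empty_subset _, continuousOn_const, 0, by simp⟩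

/-- At a local minimizer the first variation vanishes in the directions supported where the
constraints are inactive. -/
theorem IsLocalMinimizer.firstVar_eq_zero (hQ : Q.Regular) (hloc : Q.IsLocalMinimizer z)
    (hμ : Q.IsComplementary μ z) {S : Set ℝ} (hS : IsCompact S) (hSI : S ⊆ Icc Q.t0 Q.tf)
    (hzS : ContinuousOn z S) (hin : ∀ t ∈ S, ∀ l, Q.g l (z t) t < 0) {η : ℝ → Jet k}
    (hη : IsIntegratorPath Q.t0 Q.tf η) (hoff : ∀ t ∈ Icc Q.t0 Q.tf, t ∉ S → η t = 0)
    (hbd : ∀ r : ℝ, Q.bd z + r • Q.bd η ∈ Q.B) : Q.firstVar μ z η = 0 := by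
  obtain ⟨⟨hz, hfeas⟩, δ, hδ, hmin⟩ := hloc
  -- Complementarity with `g < 0` removes the multipliers on `S`, and `η` vanishes elsewhere, so the
  -- variation is that of the plain cost.
  have hμ0 : ∀ t ∈ S, μ t = 0 := fun t ht => funext fun l =>
    (mul_eq_zero.1 (hμ t (hSI ht) l).2).resolve_right (hin t ht l).ne
  have hvar : Q.firstVar μ z η = Q.firstVar 0 z η := by
    unfold firstVar
    congr 1
    refine intervalIntegral.integral_congr fun t ht => ?_
    rw [uIcc_of_le hQ.lt.le] at ht
    by_cases htS : t ∈ S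
    · simp [hμ0 t htS]
    · simp [hoff t ht htS]
  obtain ⟨C, hC⟩ : ∃ C : ℝ, ∀ t ∈ Icc Q.t0 Q.tf, ‖η t‖ ≤ C := by
    obtain ⟨-, -, -, -, -, h, -⟩ := hη
    exact h
  obtain ⟨K, hK, hKY, hzK⟩ := hz.2.1
  obtain ⟨ε₁, hε₁, hY⟩ := exists_forall_add_smul_mem hK hQ.isOpen hKY C
  have hopen : IsOpen (⋂ l, (Q.Y ×ˢ univ) ∩ (fun x : Jet k × ℝ => Q.g l x.1 x.2) ⁻¹' Iio 0) :=
    isOpen_iInter_of_finite fun l =>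
      (hQ.g l).continuousOn.isOpen_inter_preimage (hQ.isOpen.prod isOpen_univ) isOpen_Iio
  obtain ⟨ε₂, hε₂, hg⟩ := exists_forall_add_smul_mem
    (hS.image_of_continuousOn (hzS.prodMk continuousOn_id)) hopen (by
      rintro _ ⟨t, ht, rfl⟩
      exact mem_iInter.2 fun l => ⟨⟨hz.mem_Y (hSI ht), mem_univ _⟩, hin t ht l⟩) C
  have hC0 : 0 ≤ C := (norm_nonneg _).trans (hC Q.t0 ⟨le_rfl, hQ.lt.le⟩)
  -- The three bounds on `ε` keep the path in `Y`, the constraints negative on `S`, and the distance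
  -- to `z` at most `δ`.
  have hsmall : ∀ ε ∈ Icc (-min ε₁ (min ε₂ (δ / (C + 1)))) (min ε₁ (min ε₂ (δ / (C + 1)))),
      Q.cost z ≤ Q.cost fun t => z t + ε • η t := by
    intro ε hε
    have hε' := abs_le.2 hε
    have h1 : ε ∈ Icc (-ε₁) ε₁ := abs_le.1 (hε'.trans (min_le_left _ _))
    have h2 : ε ∈ Icc (-ε₂) ε₂ := abs_le.1 (hε'.trans ((min_le_right _ _).trans (min_le_left _ _)))
    have h3 : |ε| ≤ δ / (C + 1) := hε'.trans ((min_le_right _ _).trans (min_le_right _ _))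
    refine hmin _ ⟨⟨hz.1.add_smul hη ε, ?_, ?_⟩, fun t ht l => ?_⟩ fun t ht => ?_
    · refine ⟨(fun y : Jet k × Jet k => y.1 + ε • y.2) '' (K ×ˢ Metric.closedBall 0 C),
        (hK.prod (isCompact_closedBall _ _)).image (by fun_prop), ?_, fun t ht =>
        ⟨(z t, η t), ⟨hzK t ht, by simpa using hC t ht⟩, rfl⟩⟩
      rintro _ ⟨y, hy, rfl⟩
      exact hY ε h1 _ hy.1 _ hy.2
    · exact hbd ε
    · by_cases htS : t ∈ S
      · have h4 := mem_iInter.1 (hg ε h2 (z t, t) ⟨t, htS, rfl⟩ (η t, 0)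
          (by simpa [Prod.norm_def, hC0] using hC t ht)) l
        have h5 : Q.g l (z t + ε • η t) (t + ε • 0) < 0 := h4.2
        simp only [smul_zero, add_zero] at h5
        exact h5.le
      · simpa [hoff t ht htS] using hfeas t ht l
    · rw [add_sub_cancel_left, norm_smul, Real.norm_eq_abs]
      calc |ε| * ‖η t‖ ≤ δ / (C + 1) * (C + 1) := by
            gcongr
            linarith [hC t ht]
        _ = δ := by field_simp
  have hd := hasDerivAt_augCost hQ hz isPiecewise_zero hη
  simp only [← cost_eq_augCost_zero] at hd
  rw [hvar]
  refine IsLocalMin.hasDerivAt_eq_zero ?_ hd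
  have hpos : 0 < min ε₁ (min ε₂ (δ / (C + 1))) := by positivity
  filter_upwards [Icc_mem_nhds (neg_lt_zero.2 hpos) hpos] with ε hε
  simpa using hsmall ε hε

/-- For convex data, a feasible stationary trajectory with complementary multipliers is a global
minimizer. -/
theorem IsStationary.isMinimizer (hQ : Q.Regular) (hμ : IsPiecewise Q.t0 Q.tf μ)
    (hΦ : ConvexOn ℝ Q.Y Q.Phi) (hΨ : ConvexOn ℝ Q.Y Q.Psi)
    (hg : ∀ t ∈ Icc Q.t0 Q.tf, ∀ l, ConvexOn ℝ Q.Y fun w => Q.g l w t) (hB : Convex ℝ Q.B)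
    (hz : Q.IsFeasible z) (hc : Q.IsComplementary μ z) (hs : Q.IsStationary μ z) :
    Q.IsMinimizer z := by
  refine ⟨hz, fun z' hz' => ?_⟩
  have hζ : IsIntegratorPath Q.t0 Q.tf fun t => z' t + (-1 : ℝ) • z t := hz'.1.1.add_smul hz.1.1 _
  have hsub : ∀ t, z' t + (-1 : ℝ) • z t = z' t - z t := fun t => by
    rw [neg_one_smul, sub_eq_add_neg]
  have hbd : Q.bd (fun t => z' t + (-1 : ℝ) • z t) ∈ tangentConeAt ℝ Q.B (Q.bd z) := by
    have h := mem_tangentConeAt_of_segment_subset (hB.segment_subset hz.1.2.2 hz'.1.2.2)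
    have e : Q.bd (fun t => z' t + (-1 : ℝ) • z t) = Q.bd z' - Q.bd z := by
      funext b q
      simp [bd, sub_eq_add_neg]
    rwa [e]
  have h0 := (isStationary_iff hQ hz.1 hμ).1 hs _ hζ hbd
  have hi0 := intervalIntegrable_lagrDeriv hQ hz.1 hμ hζ
  simp only [firstVar, hsub] at h0 hi0
  have hi : ∀ w, Q.IsTrajectory w → IntervalIntegrable (fun t => Q.Psi (w t)) volume Q.t0 Q.tf :=
    fun w hw => by
      simpa [lagr] using intervalIntegrable_lagr hQ hw (isPiecewise_zero (Q := Q))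
  have htf : Q.tf ∈ Icc Q.t0 Q.tf := ⟨hQ.lt.le, le_rfl⟩
  have h1 := fderiv_sub_le_of_convexOn hΦ (hz.1.mem_Y htf) (hz'.1.mem_Y htf)
    (hQ.hasFDerivAt_phi (hz.1.mem_Y htf))
  have h2 : ∫ t in Q.t0..Q.tf, Q.lagrDeriv (μ t) (z t) t (z' t - z t) ≤
      ∫ t in Q.t0..Q.tf, (Q.Psi (z' t) - Q.Psi (z t)) := by
    refine intervalIntegral.integral_mono_on hQ.lt.le hi0 ((hi _ hz'.1).sub (hi _ hz.1))
      fun t ht => ?_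
    have hw := hz.1.mem_Y ht
    have hw' := hz'.1.mem_Y ht
    have h3 := fderiv_sub_le_of_convexOn hΨ hw hw' (hQ.hasFDerivAt_psi hw)
    -- By the gradient inequality each term is at most `μ_l g_l` at `z'` minus `μ_l g_l` at `z`; the
    -- former is nonpositive, the latter zero.
    have h4 : ∑ l, μ t l * fderiv ℝ (fun w => Q.g l w t) (z t) (z' t - z t) ≤ 0 := by
      refine Finset.sum_nonpos fun l _ => ?_
      have h5 := mul_le_mul_of_nonneg_left (fderiv_sub_le_of_convexOn (hg t ht l) hw hw'
        (hQ.hasFDerivAt_g l hw t)) (hc t ht l).1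
      have h6 := mul_nonpos_of_nonneg_of_nonpos (hc t ht l).1 (hz'.2 t ht l)
      have h7 := (hc t ht l).2
      rw [mul_sub, h7] at h5
      linarith
    have h8 : Q.lagrDeriv (μ t) (z t) t (z' t - z t) = fderiv ℝ Q.Psi (z t) (z' t - z t) +
        ∑ l, μ t l * fderiv ℝ (fun w => Q.g l w t) (z t) (z' t - z t) := by
      simp [lagrDeriv]
    rw [h8]
    linarith
  rw [intervalIntegral.integral_sub (hi _ hz'.1) (hi _ hz.1)] at h2
  unfold cost
  linarith

end Problem

end FlatControl

end

/-! ### Assembly of the theorem. -/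

open FlatControl FlatControl.Problem

theorem corollary3 {m c : ℕ} {k : Fin m → ℕ} (Q : FlatControl.Problem k c) (hQ : Q.Regular)
    -- the trajectory and the multipliers
    (z : ℝ → FlatControl.Jet k) (hz : Q.IsTrajectory z)
    (μ : ℝ → Fin c → ℝ) (hμ : FlatControl.IsPiecewise Q.t0 Q.tf μ)
    -- the state `p = (i, j)` is free at the endpoint `b`, and carries no final cost there
    (b : FlatControl.Endpoint) (p : FlatControl.StateIdx k) (hfree : Q.IsFree b p)
    (hPhi : b = FlatControl.Endpoint.final →
      FlatControl.pderiv Q.Phi (FlatControl.here p) (z Q.tf) = 0)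
    -- the arc adjacent to `b` is free of junctions, and the time derivatives exist on it
    (t1 : ℝ) (ht1 : t1 ∈ Set.Ioo Q.t0 Q.tf)
    (hzarc : ContinuousOn z (Q.arc b t1)) (hμarc : ContinuousOn μ (Q.arc b t1))
    (hsmooth : ∀ q : FlatControl.JetIdx k,
      ContDiffOn ℝ (q.2 : ℕ) (Q.gradAlong μ z q) (Q.arc b t1)) :
    -- equivalence with the vanishing of the costate
    (∀ lam : ℝ → FlatControl.StateIdx k → ℝ, Q.IsCostateOn (Q.arc b t1) μ z lam →
      (lam (Q.time b) p = 0 ↔ Q.costateFree (Q.arc b t1) μ z p (Q.time b) = 0)) ∧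
    -- costates exist
    ((Q.fixAt b p (z (Q.time b) (FlatControl.here p))).IsStationary μ z →
      ∃ lam : ℝ → FlatControl.StateIdx k → ℝ, Q.IsCostateOn (Q.arc b t1) μ z lam) ∧
    -- the condition replaces the missing boundary condition in first-order optimality
    (Q.IsStationary μ z ↔
      (Q.fixAt b p (z (Q.time b) (FlatControl.here p))).IsStationary μ z ∧
        Q.costateFree (Q.arc b t1) μ z p (Q.time b) = 0) ∧
    -- it guarantees global optimality for convex data
    (ConvexOn ℝ Q.Y Q.Phi → ConvexOn ℝ Q.Y Q.Psi →
      (∀ t ∈ Set.Icc Q.t0 Q.tf, ∀ l, ConvexOn ℝ Q.Y (fun w => Q.g l w t)) → Convex ℝ Q.B →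
      Q.IsFeasible z → Q.IsComplementary μ z →
      (Q.fixAt b p (z (Q.time b) (FlatControl.here p))).IsStationary μ z →
      Q.costateFree (Q.arc b t1) μ z p (Q.time b) = 0 → Q.IsMinimizer z) ∧
    -- it is necessary for local optimality where the trajectory constraints are inactive
    (Q.IsLocalMinimizer z → Q.IsComplementary μ z →
      (∀ t ∈ Q.arc b t1, ∀ l, Q.g l (z t) t < 0) →
      Q.costateFree (Q.arc b t1) μ z p (Q.time b) = 0) := by
  obtain ⟨α, β, hαβ, hα, hβ, harc, -⟩ := exists_arc_eq (b := b) ht1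
  have hS : UniqueDiffOn ℝ (Q.arc b t1) := harc ▸ uniqueDiffOn_Icc hαβ
  have hSI : Q.arc b t1 ⊆ Icc Q.t0 Q.tf := harc ▸ Icc_subset_Icc hα hβ
  have hzS : ∀ t ∈ Q.arc b t1, z t ∈ Q.Y := fun t ht => hz.mem_Y (hSI ht)
  have htb : Q.time b ∈ Q.arc b t1 := by
    cases b
    · exact ⟨le_rfl, ht1.1.le⟩
    · exact ⟨ht1.2.le, le_rfl⟩
  obtain ⟨φ, hφ, hoff, hbd, hiff⟩ := exists_variation b p hPhi ht1 hsmooth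
  have hη : IsIntegratorPath Q.t0 Q.tf (jetPath p.1 φ : ℝ → Jet k) := isIntegratorPath_jetPath _ hφ
  have hfix := isStationary_fixAt_iff hQ hz hμ b p (z (Q.time b) (here p))
  have hstat := isStationary_iff hQ hz hμ
  have hEL : ∀ i, (∀ φ : ℝ → ℝ, ContDiff ℝ ∞ φ →
      (∀ t ∈ Icc Q.t0 Q.tf, t ∉ Q.arc b t1 → ∀ n, iteratedDeriv n φ t = 0) →
      Q.bd (jetPath i φ) = 0 → Q.firstVar μ z (jetPath i φ) = 0) →
      ∀ t ∈ Q.arc b t1, altSum (Q.arc b t1) (Q.chainGrad μ z i) (k i) 0 t = 0 := by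
    rw [harc] at hsmooth ⊢
    exact altSum_zero_eq_zero hαβ hα hβ hsmooth
  have hELfix : (Q.fixAt b p (z (Q.time b) (here p))).IsStationary μ z → ∀ i,
      ∀ t ∈ Q.arc b t1, altSum (Q.arc b t1) (Q.chainGrad μ z i) (k i) 0 t = 0 := by
    intro h i
    refine hEL i fun ψ hψ _ h0 => hfix.1 h _ (isIntegratorPath_jetPath i hψ) ?_
    rw [h0]
    -- Variations with zero boundary values are tangent to every boundary condition that `z` meets,
    -- so the fixed problem already yields Euler-Lagrange.
    exact zero_mem_tangentConeAt (subset_closure ⟨hz.2.2, rfl⟩)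
  have hmain : Q.IsStationary μ z ↔ (Q.fixAt b p (z (Q.time b) (here p))).IsStationary μ z ∧
      Q.costateFree (Q.arc b t1) μ z p (Q.time b) = 0 := by
    constructor
    · intro h
      have h' : (Q.fixAt b p (z (Q.time b) (here p))).IsStationary μ z :=
        hfix.2 fun ζ hζ hT => hstat.1 h ζ hζ (tangentConeAt_mono inter_subset_left hT)
      refine ⟨h', (hiff (hELfix h' p.1)).1 (hstat.1 h _ hη ?_)⟩
      rw [hbd]
      exact hfree.bdUnit_mem_tangentConeAt hz.2.2
    · rintro ⟨h, h0⟩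
      refine hstat.2 fun ζ hζ hT => ?_
      -- Subtracting `ζ`'s boundary component at `p` along `η` makes the variation tangent to the
      -- fixed problem; by (∗) this leaves the first variation unchanged.
      have h1 := hfix.1 h _ (hζ.add_smul hη (-Q.bd ζ b p)) (by
        have h2 := hfree.sub_smul_mem_tangentConeAt hT
        rw [← hbd] at h2
        exact h2)
      rwa [firstVar_add_smul hQ hz hμ hζ hη, (hiff (hELfix h p.1)).2 h0, mul_zero, add_zero] at h1
  refine ⟨fun lam hlam => ?_, fun h => exists_isCostateOn hQ hS hzS hsmooth (hELfix h), hmain,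
    fun hΦ hΨ hg hB hfeas hc h h0 =>
      IsStationary.isMinimizer hQ hμ hΦ hΨ hg hB hfeas hc (hmain.2 ⟨h, h0⟩), fun hloc hc hin => ?_⟩
  · rw [costate_eq_costateFree hQ hS hzS hsmooth hlam p htb]
  · have hzero : ∀ (i : Fin m) (ψ : ℝ → ℝ), ContDiff ℝ ∞ ψ →
        (∀ t ∈ Icc Q.t0 Q.tf, t ∉ Q.arc b t1 → ∀ n, iteratedDeriv n ψ t = 0) →
        (∀ r : ℝ, Q.bd z + r • Q.bd (jetPath i ψ) ∈ Q.B) → Q.firstVar μ z (jetPath i ψ) = 0 :=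
      fun i ψ hψ hψ0 hB => hloc.firstVar_eq_zero hQ hc (harc ▸ isCompact_Icc) hSI hzarc hin
        (isIntegratorPath_jetPath i hψ) (fun t ht ht' => jetPath_eq_zero (hψ0 t ht ht')) hB
    -- Local minimality is used twice: along variations with zero boundary values for the
    -- Euler-Lagrange equation, then along the one that moves `p`.
    refine (hiff (hEL p.1 fun ψ hψ hψ0 h0 => hzero p.1 ψ hψ hψ0 fun r => ?_)).1
      (hzero p.1 φ hφ hoff fun r => ?_)
    · simpa [h0] using hz.2.2
    · rw [hbd]
      exact hfree.add_smul_mem hz.2.2 r
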